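/- **Setting.** For a partition $P$ of $[n]=\{1,\dots,n\}$, the arcs of $P$ are the pairs $(a,b)$, $a<b$, of consecutive elements (in numerical order) of a block; $a$ is the left-hand and $b$ the right-hand endpoint of the arc. For $S,T\subseteq[n]$ with $|S|=|T|$, let $P_n(S,T)$ be the set of partitions of $[n]$ whose set of minimal block elements is $S$ and whose set of maximal block elements is $T$. Two arcs $(i_1,j_1),(i_2,j_2)$ cross if $i_1<i_2<j_1<j_2$ or $i_2<i_1<j_2<j_1$. **The map $\phi$ on matchings.** Let $M$ be a perfect matching of a finite linearly ordered set, given by its arcs (pairs $(a,b)$ with $a<b$). Define $\phi(M)$ by recursion on the number of arcs, with $\phi(\emptyset)=\emptyset$. If $M\neq\emptyset$, let $t$ be the largest vertex, $(i,t)$ its arc, and $N=\phi(M\setminus\{(i,t)\})$. Call an arc $(a,b)$ with $a\ne i$ large if $a<i$ and small if $a>i$. Let $\mathcal R$ be the set of right-hand endpoints $j$ of $N$ with $i<j<t$. Let $e_L=(e_L^l,e_L^r)$ be the large arc of $N$ with the biggest right-hand endpoint in $\mathcal R$, and $e_S=(e_S^l,e_S^r)$ the small arc of $N$ with the smallest left-hand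 endpoint among those crossing $e_L$. If $e_S$ exists, put $\mathcal R_1=\{j\in\mathcal R: e_S^l<j\le e_S^r\}$ and $\mathcal R_2=\{j\in\mathcal R: j<e_S^l\}$. If $e_L$ exists but $e_S$ does not, put $\mathcal R_1=\emptyset$ and $\mathcal R_2=\{j\in\mathcal R: j\le e_L^r\}$. If $e_L$ does not exist, put $\mathcal R_1=\mathcal R_2=\emptyset$. Starting with the matching $N$, carry out the following two algorithms in turn; at each moment $(i_k,j_k)$ denotes the arc of the current matching with right-hand endpoint $j_k$. *Algorithm I* (if $\mathcal R_1\ne\emptyset$). Put $j_1=e_S^r$, and let $j_2$ run through the elements of $\mathcal R_1$ smaller than $e_S^r$ in decreasing order. For each $j_2$: (B1) if $(i_2,j_2)$ is large, change $(i_1,j_1),(i_2,j_2)$ to $(i_1,j_2),(i_2,j_1)$ and then set $j_1:=j_2$; (B2.1) if $(i_2,j_2)$ is small and no right-hand endpoint lies between $i_1$ and $i_2$, set $j_1:=j_2$; (B2.2) if $(i_2,j_2)$ is small, $i_1<i_2$ and some right-hand endpoint lies between $i_1$ and $i_2$, do nothing; (B2.3) if $(i_2,j_2)$ is small, $i_2<i_1$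 and some right-hand endpoint lies between $i_1$ and $i_2$, take the smallest $j_3>j_1$ whose arc $(i_3,j_3)$ is large, change $(i_1,j_1),(i_2,j_2),(i_3,j_3)$ to $(i_1,j_2),(i_2,j_3),(i_3,j_1)$, and then set $j_1:=j_2$. *Algorithm II* (if $\mathcal R_2\ne\emptyset$). Let $t_0=\max\mathcal R_2$, with arc $(i_0,t_0)$. If this arc is small, take the smallest $t_1>t_0$ whose arc $(i_1,t_1)$ is large and change $(i_0,t_0),(i_1,t_1)$ to $(i_0,t_1),(i_1,t_0)$. Then put $j_1=t_0$, and let $j_2$ run through the elements of $\mathcal R$ smaller than $t_0$ in decreasing order. For each $j_2$: if $(i_2,j_2)$ is small, change $(i_1,j_1),(i_2,j_2)$ to $(i_1,j_2),(i_2,j_1)$; in either case then set $j_1:=j_2$. If $M_2$ is the resulting matching, put $\phi(M)=M_2\cup\{(i,t)\}$. **The map $\phi$ on partitions.** For a partition $P$ of $[n]$, let $M(P)$ be the matching obtained from the arcs of $P$ by replacing each vertex $i\notin S\cup T$ (where $S,T$ are the sets of minimal and maximal block elements of $P$) by two neighbouring vertices $i^0<i^1$, the arc ending at $i$ being attached to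 $i^0$ and the arc starting at $i$ to $i^1$, and by removing the isolated vertices. Then $\phi(P)$ is the partition obtained from $\phi(M(P))$ by identifying $i^0$ with $i^1$ for all such $i$ and adding back the isolated vertices, the blocks being the connected components. **Theorem.** Let $S,T\subseteq[n]$ with $|S|=|T|$. The map $\phi$ is well defined on $P_n(S,T)$: all arcs sought in the algorithms exist, and every exchange of arcs produces pairs $(a,b)$ with $a<b$. For every $P\in P_n(S,T)$ we have $\phi(P)\in P_n(S,T)$ and $M(\phi(P))=\phi(M(P))$, and $\phi(P)$ has the same set of left-hand endpoints and the same set of right-hand endpoints as $P$. The map $\phi:P_n(S,T)\to P_n(S,T)$ is a bijection. -/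

import Mathlib

namespace ArcDiagram

section Matching

variable {V : Type*} [LinearOrder V]

/-- The smallest element of a finite set, if there is one. -/
def minOpt (s : Finset V) : Option V :=
  if h : s.Nonempty then some (s.min' h) else none

/-- The largest element of a finite set, if there is one. -/
def maxOpt (s : Finset V) : Option V :=
  if h : s.Nonempty then some (s.max' h) else none

/-- The left-hand endpoints of a set of arcs; an arc is a pair `(i, j)` with `i < j`. -/
def lefts (M : Finset (V × V)) : Finset V := M.image Prod.fst

/-- The right-hand endpoints of a set of arcs. -/
def rights (M : Finset (V × V)) : Finset V := M.image Prod.snd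

/-- The left-hand endpoint of the arc of `M` that ends at `j` (`none` if there is no such arc). -/
def leftOf (M : Finset (V × V)) (j : V) : Option V :=
  minOpt (lefts (M.filter fun e => e.2 = j))

/-- The right-hand endpoint of the arc of `M` that starts at `i` (`none` if there is none). -/
def rightOf (M : Finset (V × V)) (i : V) : Option V :=
  minOpt (rights (M.filter fun e => e.1 = i))

/-- Two arcs cross: `i₁ < i₂ < j₁ < j₂` for one of the two orders of the arcs. -/
def Crosses (e f : V × V) : Prop :=
  (e.1 < f.1 ∧ f.1 < e.2 ∧ e.2 < f.2) ∨ (f.1 < e.1 ∧ e.1 < f.2 ∧ f.2 < e.2)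

instance (e f : V × V) : Decidable (Crosses e f) := by
  unfold Crosses; infer_instance

/-- Some right-hand endpoint of `M` lies strictly between `a` and `b` (in either order). -/
def HasRightBetween (M : Finset (V × V)) (a b : V) : Prop :=
  ∃ j ∈ rights M, min a b < j ∧ j < max a b

instance (M : Finset (V × V)) (a b : V) : Decidable (HasRightBetween M a b) := by
  unfold HasRightBetween; infer_instance

/-- Change the arcs `old` of `M` to the arcs `new`. This is undefined if one of the new pairs
is not an arc, i.e. if its first entry is not smaller than its second entry. -/
def exchange (M old new : Finset (V × V)) : Option (Finset (V × V)) :=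
  if ∀ e ∈ new, e.1 < e.2 then some ((M \ old) ∪ new) else none

/-! In what follows `(i, t)` is the removed last arc, and `N` is a matching on the remaining
vertices. An arc `(a, b)` of `N` is large if `a < i` and small if `i < a`. -/

/-- `R`: the right-hand endpoints of `N` between `i` and `t`. -/
def regionR (N : Finset (V × V)) (i t : V) : Finset V :=
  (rights N).filter fun j => i < j ∧ j < t

/-- The critical large arc: the large arc with the biggest right-hand endpoint in `R`. -/
def criticalLarge (N : Finset (V × V)) (i t : V) : Option (V × V) := do
  let r ← maxOpt (rights (N.filter fun e => e.1 < i ∧ e.2 ∈ regionR N i t))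
  let l ← leftOf N r
  some (l, r)

/-- The critical small arc: the small arc with the smallest left-hand endpoint which crosses
the critical large arc. -/
def criticalSmall (N : Finset (V × V)) (i t : V) : Option (V × V) := do
  let eL ← criticalLarge N i t
  let l ← minOpt (lefts (N.filter fun e => i < e.1 ∧ Crosses e eL))
  let r ← rightOf N l
  some (l, r)

/-- `R₁`. -/
def regionR1 (N : Finset (V × V)) (i t : V) : Finset V :=
  match criticalSmall N i t with
  | none => ∅
  | some eS => (regionR N i t).filter fun j => eS.1 < j ∧ j ≤ eS.2

/-- `R₂`. -/
def regionR2 (N : Finset (V × V)) (i t : V) : Finset V :=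
  match criticalLarge N i t with
  | none => ∅
  | some eL =>
    match criticalSmall N i t with
    | none => (regionR N i t).filter fun j => j ≤ eL.2
    | some eS => (regionR N i t).filter fun j => j < eS.1

/-- The right-hand endpoint, nearest to the right of `j`, of a large arc of `M`. -/
def nextLarge (M : Finset (V × V)) (i j : V) : Option V :=
  minOpt (rights (M.filter fun e => e.1 < i ∧ j < e.2))

/-- The vertices of `s` to the left of `j`, listed from right to left. -/
def leftwards (s : Finset V) (j : V) : List V :=
  (s.filter fun k => k < j).sort (· ≥ ·)

/-- One pass through step (B) of Algorithm I. The state is the current matching together with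
the position of the first pointer; `j₂` is the position of the second pointer. The four
branches are (B1), (B2.1), (B2.2), (B2.3). -/
def stepI (i : V) (st : Finset (V × V) × V) (j₂ : V) : Option (Finset (V × V) × V) := do
  let M := st.1
  let j₁ := st.2
  let i₁ ← leftOf M j₁
  let i₂ ← leftOf M j₂
  if i₂ < i then
    let M' ← exchange M {(i₁, j₁), (i₂, j₂)} {(i₁, j₂), (i₂, j₁)}
    some (M', j₂)
  else if ¬ HasRightBetween M i₁ i₂ then
    some (M, j₂)
  else if i₁ < i₂ then
    some (M, j₁)
  else
    let j₃ ← nextLarge M i j₁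
    let i₃ ← leftOf M j₃
    let M' ← exchange M {(i₁, j₁), (i₂, j₂), (i₃, j₃)} {(i₁, j₂), (i₂, j₃), (i₃, j₁)}
    some (M', j₂)

/-- Algorithm I: the first pointer starts at the right-hand endpoint of the critical small arc,
the second one runs through the other vertices of `R₁` from right to left. -/
def algorithmI (N : Finset (V × V)) (i t : V) : Option (Finset (V × V)) :=
  match criticalSmall N i t with
  | none => some N
  | some eS => do
    let st ← (leftwards (regionR1 N i t) eS.2).foldlM (stepI i) (N, eS.2)
    some st.1

/-- The pre-processing step ("borrowing") of Algorithm II at the vertex `t₀`. -/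
def borrow (M : Finset (V × V)) (i t₀ : V) : Option (Finset (V × V)) := do
  let i₀ ← leftOf M t₀
  if i₀ < i then
    some M
  else
    let t₁ ← nextLarge M i t₀
    let i₁ ← leftOf M t₁
    exchange M {(i₀, t₀), (i₁, t₁)} {(i₀, t₁), (i₁, t₀)}

/-- One pass through steps (B') and (C') of Algorithm II. -/
def stepII (i : V) (st : Finset (V × V) × V) (j₂ : V) : Option (Finset (V × V) × V) := do
  let M := st.1
  let j₁ := st.2
  let i₁ ← leftOf M j₁
  let i₂ ← leftOf M j₂
  if i₂ < i then
    some (M, j₂)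
  else
    let M' ← exchange M {(i₁, j₁), (i₂, j₂)} {(i₁, j₂), (i₂, j₁)}
    some (M', j₂)

/-- Algorithm II, applied to the current matching `M`; the regions are those of `N`. -/
def algorithmII (N : Finset (V × V)) (i t : V) (M : Finset (V × V)) :
    Option (Finset (V × V)) :=
  match maxOpt (regionR2 N i t) with
  | none => some M
  | some t₀ => do
    let M₀ ← borrow M i t₀
    let st ← (leftwards (regionR N i t) t₀).foldlM (stepII i) (M₀, t₀)
    some st.1

/-- The map `φ` on matchings with `m` arcs, by recursion on `m`. -/
def phiAux : ℕ → Finset (V × V) → Option (Finset (V × V))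
  | 0, M => some M
  | m + 1, M => do
    let t ← maxOpt (rights M)
    let i ← leftOf M t
    let N ← phiAux m (M.erase (i, t))
    let M₁ ← algorithmI N i t
    let M₂ ← algorithmII N i t M₁
    some (insert (i, t) M₂)

/-- The map `φ` on matchings of a linearly ordered vertex set, given by their arcs. The value is
`none` if some step of the algorithms cannot be carried out. -/
def phiMatching (M : Finset (V × V)) : Option (Finset (V × V)) := phiAux M.card M

end Matching

section Partition

variable {n : ℕ}

/-- Partitions of an `n`-element chain, with `Fin n` in place of `{1, …, n}`. -/
abbrev SetPartition (n : ℕ) := Finpartition (Finset.univ : Finset (Fin n))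

/-- The minimal block elements. -/
def minElems (P : SetPartition n) : Finset (Fin n) :=
  Finset.univ.filter fun x => ∃ B ∈ P.parts, x ∈ B ∧ ∀ y ∈ B, x ≤ y

/-- The maximal block elements. -/
def maxElems (P : SetPartition n) : Finset (Fin n) :=
  Finset.univ.filter fun x => ∃ B ∈ P.parts, x ∈ B ∧ ∀ y ∈ B, y ≤ x

/-- `P_n(S, T)`. -/
def partitionsST (S T : Finset (Fin n)) : Set (SetPartition n) :=
  {P | minElems P = S ∧ maxElems P = T}

/-- The arcs of the standard representation: pairs of consecutive elements of a block. -/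
def arcs (P : SetPartition n) : Finset (Fin n × Fin n) :=
  Finset.univ.filter fun e =>
    ∃ B ∈ P.parts, e.1 ∈ B ∧ e.2 ∈ B ∧ e.1 < e.2 ∧ ∀ x ∈ B, ¬ (e.1 < x ∧ x < e.2)

/-- The vertices of the matching `M(P)`: `i⁰ = (i, 0)` and `i¹ = (i, 1)`, in lexicographic order.
A vertex that is only a right-hand endpoint of `P` is written as `(i, 0)`, and one that is only
a left-hand endpoint as `(i, 1)`; this does not affect the order of the vertices. -/
abbrev SplitVertex (n : ℕ) := Fin n ×ₗ Fin 2

/-- The matching `M(P)`: an arc `(a, b)` of `P` becomes `(a¹, b⁰)`. -/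
def toMatching (P : SetPartition n) : Finset (SplitVertex n × SplitVertex n) :=
  (arcs P).image fun e => (toLex (e.1, 1), toLex (e.2, 0))

open Classical in
/-- Identify `i⁰` and `i¹` for every `i`, and add back the isolated vertices: the blocks are the
connected components of the resulting graph on all `n` vertices. -/
noncomputable def ofMatching (M : Finset (SplitVertex n × SplitVertex n)) : SetPartition n :=
  Finpartition.ofSetoid
    (Relation.EqvGen.setoid fun a b : Fin n =>
      ∃ e ∈ M, (ofLex e.1).1 = a ∧ (ofLex e.2).1 = b)

/-- The map `φ` on set partitions. -/
noncomputable def phi (P : SetPartition n) : Option (SetPartition n) :=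
  (phiMatching (toMatching P)).map ofMatching

end Partition

end ArcDiagram

/-!
A matching is its last arc `(i, t)` together with the map `σ` sending every other right-hand
endpoint to its partner, so it suffices that the two algorithms, for given `i`, are injective on
such maps. All their exchanges have a left inverse on the states that occur. Algorithm II is a sweep
from right to left in which every vertex `k` with a small arc borrows the partner of the next large
arc. All arcs involved start before a fixed vertex `d`, and `k` has borrowed if and only if the
first arc to its right that starts before `d` is small. If `e_S` starts between the consecutive
right-hand endpoints `d < f`, then Algorithm I moves an arc starting in this gap from right to left,
borrowing where it leaves a vertex, until it ends at `f`.

It remains to read off from the outcome where the sweeps have started. The arc of `f` is small and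
has no right-hand endpoint below it, which happens at no earlier vertex and, if `e_S` does not
exist, at no vertex reached by the sweep but at the next one after it. This determines `f` and `d`,
and the last arc that starts before `f` ends at the same vertex before and after. So `φ` is
injective; as it preserves the sets of left- and right-hand endpoints, it permutes a finite set.
-/

namespace ArcDiagram

section Sweeps

variable {V α β : Type*} [LinearOrder V] {s : Finset V} {m j : V}

theorem minOpt_eq_some_iff : minOpt s = some m ↔ IsLeast (s : Set V) m := by
  unfold minOpt
  split_ifs with hs
  · rw [Option.some_inj]
    exact ⟨fun h => h ▸ s.isLeast_min' hs, (s.isLeast_min' hs).unique⟩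
  · simp [Finset.not_nonempty_iff_eq_empty.1 hs, IsLeast]

theorem maxOpt_eq_some_iff : maxOpt s = some m ↔ IsGreatest (s : Set V) m := by
  unfold maxOpt
  split_ifs with hs
  · rw [Option.some_inj]
    exact ⟨fun h => h ▸ s.isGreatest_max' hs, (s.isGreatest_max' hs).unique⟩
  · simp [Finset.not_nonempty_iff_eq_empty.1 hs, IsGreatest]

theorem minOpt_empty : minOpt (∅ : Finset V) = none := by simp [minOpt]

theorem maxOpt_empty : maxOpt (∅ : Finset V) = none := by simp [maxOpt]

/-- `m` is the last element of `s` before `j`, that is, the vertex visited next when `s` is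
traversed from right to left and all its elements from `j` on have been visited. -/
structure IsLastBefore (s : Finset V) (j m : V) : Prop where
  mem : m ∈ s
  lt : m < j
  le : ∀ k ∈ s, k < j → k ≤ m

theorem exists_isLastBefore {k : V} (hk : k ∈ s) (hkj : k < j) : ∃ m, IsLastBefore s j m := by
  obtain ⟨m, hm, hmax⟩ := Finset.exists_max_image (s.filter (· < j)) id
    ⟨k, Finset.mem_filter.2 ⟨hk, hkj⟩⟩
  rw [Finset.mem_filter] at hm
  exact ⟨m, hm.1, hm.2, fun k hk hkj => hmax k (Finset.mem_filter.2 ⟨hk, hkj⟩)⟩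

theorem leftwards_of_forall_le (h : ∀ k ∈ s, j ≤ k) : leftwards s j = [] := by
  rw [leftwards, Finset.filter_false_of_mem fun k hk => (h k hk).not_gt, Finset.sort_empty]

theorem IsLastBefore.leftwards_eq (h : IsLastBefore s j m) :
    leftwards s j = m :: leftwards s m := by
  have hinsert : s.filter (· < j) = insert m (s.filter (· < m)) := by
    ext k
    have := h.mem
    have := h.lt
    have := h.le k
    simp only [Finset.mem_filter, Finset.mem_insert]
    grind
  rw [leftwards, hinsert, Finset.sort_insert _ (fun k hk => (Finset.mem_filter.1 hk).2.le)
    (by simp)]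
  rfl

theorem leftwards_congr {s' : Finset V} (h : ∀ k < j, k ∈ s ↔ k ∈ s') :
    leftwards s j = leftwards s' j := by
  have : s.filter (· < j) = s'.filter (· < j) := by
    ext k
    simpa only [Finset.mem_filter] using and_congr_left (h k)
  rw [leftwards, this, leftwards]

theorem leftwards_induction {P : V → Prop} (s : Finset V)
    (base : ∀ j, (∀ k ∈ s, j ≤ k) → P j) (step : ∀ j m, IsLastBefore s j m → P m → P j)
    (j : V) : P j := by
  induction hn : (s.filter (· < j)).card using Nat.strong_induction_on generalizing j with
  | _ n ih =>
    by_cases hne : ∃ k ∈ s, k < j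
    · obtain ⟨k, hk, hkj⟩ := hne
      obtain ⟨m, hm⟩ := exists_isLastBefore hk hkj
      refine step j m hm (ih _ (hn ▸ Finset.card_lt_card ?_) m rfl)
      have hsub : s.filter (· < m) ⊆ s.filter (· < j) :=
        Finset.monotone_filter_right s fun k _ hkm => lt_trans hkm hm.lt
      refine (Finset.ssubset_iff_of_subset hsub).2 ⟨m, ?_⟩
      simp [hm.mem, hm.lt]
    · push Not at hne
      exact base j hne

/-- Apply `step` at all elements of `s` before `j`, from right to left. -/
def sweepLeft (s : Finset V) (step : α → V → α) (a : α) (j : V) : α :=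
  (leftwards s j).foldl step a

variable {step : α → V → α} {a b : α} {Inv : α → V → Prop}

theorem sweepLeft_of_forall_le (h : ∀ k ∈ s, j ≤ k) : sweepLeft s step a j = a := by
  rw [sweepLeft, leftwards_of_forall_le h, List.foldl_nil]

theorem IsLastBefore.sweepLeft_eq (h : IsLastBefore s j m) :
    sweepLeft s step a j = sweepLeft s step (step a m) m := by
  rw [sweepLeft, h.leftwards_eq, List.foldl_cons, sweepLeft]

theorem exists_inv_sweepLeft (hstep : ∀ a j m, IsLastBefore s j m → Inv a j → Inv (step a m) m)
    (ha : Inv a j) : ∃ j', (∀ k ∈ s, j' ≤ k) ∧ Inv (sweepLeft s step a j) j' := by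
  induction j using leftwards_induction s generalizing a with
  | base j hj => exact ⟨j, hj, by rwa [sweepLeft_of_forall_le hj]⟩
  | step j m hm ih =>
    rw [hm.sweepLeft_eq]
    exact ih (hstep a j m hm ha)

theorem eq_of_sweepLeft_eq (hstep : ∀ a j m, IsLastBefore s j m → Inv a j → Inv (step a m) m)
    (hinj : ∀ a b j m, IsLastBefore s j m → Inv a j → Inv b j → step a m = step b m → a = b)
    (ha : Inv a j) (hb : Inv b j) (h : sweepLeft s step a j = sweepLeft s step b j) :
    a = b := by
  induction j using leftwards_induction s generalizing a b with
  | base j hj => rwa [sweepLeft_of_forall_le hj, sweepLeft_of_forall_le hj] at h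
  | step j m hm ih =>
    rw [hm.sweepLeft_eq, hm.sweepLeft_eq] at h
    exact hinj a b j m hm ha hb (ih (hstep a j m hm ha) (hstep b j m hm hb) h)

theorem exists_foldlM_leftwards_eq_some {stepM : β → V → Option β} (encode : α → V → β)
    (hstep : ∀ a j m, IsLastBefore s j m → Inv a j → Inv (step a m) m)
    (hstepM : ∀ a j m, IsLastBefore s j m → Inv a j →
      stepM (encode a j) m = some (encode (step a m) m)) (ha : Inv a j) :
    ∃ j', (leftwards s j).foldlM stepM (encode a j) =
      some (encode (sweepLeft s step a j) j') := by
  induction j using leftwards_induction s generalizing a with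
  | base j hj => exact ⟨j, by rw [leftwards_of_forall_le hj, sweepLeft_of_forall_le hj]; rfl⟩
  | step j m hm ih =>
    rw [hm.leftwards_eq, hm.sweepLeft_eq, List.foldlM_cons, hstepM a j m hm ha]
    exact ih (hstep a j m hm ha)

end Sweeps

section Matchings

variable {V : Type*} [LinearOrder V] {K L : Finset V} {M : Finset (V × V)} {σ τ : V → V}

/-- `M` is a perfect matching of `K ∪ L` whose arcs have right-hand endpoints `K` and left-hand
endpoints `L`. -/
structure IsMatching (K L : Finset V) (M : Finset (V × V)) : Prop where
  rights_eq : rights M = K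
  lefts_eq : lefts M = L
  disjoint : Disjoint K L
  lt : ∀ e ∈ M, e.1 < e.2
  fst_injOn : Set.InjOn Prod.fst (M : Set (V × V))
  snd_injOn : Set.InjOn Prod.snd (M : Set (V × V))

/-- `σ` assigns to every right-hand endpoint of a matching the left-hand endpoint of its arc.
The value `σ k = k` outside `K` makes `σ` unique. -/
structure IsArcMap (K L : Finset V) (σ : V → V) : Prop where
  bijOn : Set.BijOn σ K L
  lt : ∀ k ∈ K, σ k < k
  eq_self : ∀ k ∉ K, σ k = k
  disjoint : Disjoint K L

/-- The arcs `(σ k, k)` of the matching described by `σ`. -/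
def arcsOf (K : Finset V) (σ : V → V) : Finset (V × V) := K.image fun k => (σ k, k)

theorem mem_arcsOf {e : V × V} : e ∈ arcsOf K σ ↔ e.2 ∈ K ∧ σ e.2 = e.1 := by
  simp only [arcsOf, Finset.mem_image, Prod.ext_iff]
  exact ⟨fun ⟨k, hk, h, hke⟩ => hke ▸ ⟨hk, h⟩, fun h => ⟨e.2, h.1, h.2, rfl⟩⟩

theorem rights_filter_arcsOf (p : V × V → Prop) [DecidablePred p] :
    rights ((arcsOf K σ).filter p) = K.filter fun k => p (σ k, k) := by
  rw [rights, arcsOf, Finset.filter_image, Finset.image_image]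
  exact Finset.image_id

theorem lefts_filter_arcsOf (p : V × V → Prop) [DecidablePred p] :
    lefts ((arcsOf K σ).filter p) = (K.filter fun k => p (σ k, k)).image σ := by
  rw [lefts, arcsOf, Finset.filter_image, Finset.image_image]
  rfl

theorem rights_arcsOf : rights (arcsOf K σ) = K := by
  simpa using rights_filter_arcsOf (K := K) (σ := σ) fun _ => True

theorem lefts_arcsOf : lefts (arcsOf K σ) = K.image σ := by
  simpa using lefts_filter_arcsOf (K := K) (σ := σ) fun _ => True

theorem leftOf_eq_some (h : Set.InjOn Prod.snd (M : Set (V × V))) {e : V × V} (he : e ∈ M) :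
    leftOf M e.2 = some e.1 := by
  have : M.filter (fun e' => e'.2 = e.2) = {e} := by
    ext e'
    simp only [Finset.mem_filter, Finset.mem_singleton]
    exact ⟨fun ⟨he', heq⟩ => h he' he heq, by rintro rfl; exact ⟨he, rfl⟩⟩
  rw [leftOf, this, minOpt_eq_some_iff]
  simp [lefts]

theorem rightOf_eq_some (h : Set.InjOn Prod.fst (M : Set (V × V))) {e : V × V} (he : e ∈ M) :
    rightOf M e.1 = some e.2 := by
  have : M.filter (fun e' => e'.1 = e.1) = {e} := by
    ext e'
    simp only [Finset.mem_filter, Finset.mem_singleton]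
    exact ⟨fun ⟨he', heq⟩ => h he' he heq, by rintro rfl; exact ⟨he, rfl⟩⟩
  rw [rightOf, this, minOpt_eq_some_iff]
  simp [rights]

theorem leftOf_arcsOf {k : V} (hk : k ∈ K) : leftOf (arcsOf K σ) k = some (σ k) := by
  refine leftOf_eq_some (e := (σ k, k)) (fun e he e' he' heq => ?_) (mem_arcsOf.2 ⟨hk, rfl⟩)
  have h := (mem_arcsOf.1 he).2
  have h' := (mem_arcsOf.1 he').2
  exact Prod.ext (h.symm.trans ((congrArg σ heq).trans h')) heq

namespace IsArcMap

theorem mem (h : IsArcMap K L σ) {k : V} (hk : k ∈ K) : σ k ∈ L := h.bijOn.mapsTo hk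

theorem ne (h : IsArcMap K L σ) {i k : V} (hi : i ∉ L) (hk : k ∈ K) : σ k ≠ i :=
  fun heq => hi (heq ▸ h.mem hk)

theorem notMem_left (h : IsArcMap K L σ) {k : V} (hk : k ∈ K) : k ∉ L :=
  Finset.disjoint_left.1 h.disjoint hk

theorem notMem_right (h : IsArcMap K L σ) {k : V} (hk : k ∈ K) : σ k ∉ K :=
  Finset.disjoint_right.1 h.disjoint (h.mem hk)

theorem isMatching_arcsOf (h : IsArcMap K L σ) : IsMatching K L (arcsOf K σ) where
  rights_eq := rights_arcsOf
  lefts_eq := by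
    rw [lefts_arcsOf, ← Finset.coe_inj, Finset.coe_image, h.bijOn.image_eq]
  disjoint := h.disjoint
  lt e he := by
    obtain ⟨hK, heq⟩ := mem_arcsOf.1 he
    exact heq ▸ h.lt e.2 hK
  fst_injOn e he e' he' heq := by
    obtain ⟨hK, hσ⟩ := mem_arcsOf.1 he
    obtain ⟨hK', hσ'⟩ := mem_arcsOf.1 he'
    exact Prod.ext heq (h.bijOn.injOn hK hK' (by rw [hσ, hσ', heq]))
  snd_injOn e he e' he' heq := by
    rw [Prod.ext_iff, ← (mem_arcsOf.1 he).2, ← (mem_arcsOf.1 he').2, heq]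
    exact ⟨rfl, rfl⟩

theorem arcsOf_injective {L' : Finset V} (hσ : IsArcMap K L σ) (hτ : IsArcMap K L' τ)
    (h : arcsOf K σ = arcsOf K τ) : σ = τ := by
  funext k
  by_cases hk : k ∈ K
  · have : (σ k, k) ∈ arcsOf K τ := h ▸ mem_arcsOf.2 ⟨hk, rfl⟩
    exact (mem_arcsOf.1 this).2.symm
  · rw [hσ.eq_self k hk, hτ.eq_self k hk]

end IsArcMap

theorem IsMatching.exists_isArcMap (h : IsMatching K L M) :
    ∃ σ, IsArcMap K L σ ∧ arcsOf K σ = M := by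
  have hleft : ∀ k, ∃ a, if k ∈ K then (a, k) ∈ M else a = k := by
    intro k
    split_ifs with hk
    · rw [← h.rights_eq, rights, Finset.mem_image] at hk
      obtain ⟨e, he, rfl⟩ := hk
      exact ⟨e.1, he⟩
    · exact ⟨k, rfl⟩
  choose σ hσ using hleft
  have hmem : ∀ k ∈ K, (σ k, k) ∈ M := fun k hk => by simpa only [if_pos hk] using hσ k
  have hsnd : ∀ e ∈ M, e.2 ∈ K ∧ (σ e.2, e.2) = e := fun e he => by
    have hK : e.2 ∈ K := h.rights_eq ▸ Finset.mem_image_of_mem Prod.snd he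
    exact ⟨hK, h.snd_injOn (hmem _ hK) he rfl⟩
  refine ⟨σ, ⟨⟨fun k hk => ?_, fun k hk k' hk' heq => ?_, fun a ha => ?_⟩,
    fun k hk => h.lt _ (hmem k hk), fun k hk => by simpa only [if_neg hk] using hσ k,
    h.disjoint⟩, ?_⟩
  · exact h.lefts_eq ▸ Finset.mem_image_of_mem Prod.fst (hmem k hk)
  · exact congrArg Prod.snd (h.fst_injOn (hmem k hk) (hmem k' hk') heq)
  · rw [← h.lefts_eq, lefts, Finset.mem_coe, Finset.mem_image] at ha
    obtain ⟨e, he, rfl⟩ := ha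
    exact ⟨e.2, (hsnd e he).1, congrArg Prod.fst (hsnd e he).2⟩
  · ext e
    rw [mem_arcsOf]
    refine ⟨fun ⟨hK, heq⟩ => ?_, fun he => ⟨(hsnd e he).1, congrArg Prod.fst (hsnd e he).2⟩⟩
    simpa only [heq] using hmem e.2 hK

theorem IsArcMap.rightOf_arcsOf (h : IsArcMap K L σ) {k : V} (hk : k ∈ K) :
    rightOf (arcsOf K σ) (σ k) = some k :=
  rightOf_eq_some (e := (σ k, k)) h.isMatching_arcsOf.fst_injOn (mem_arcsOf.2 ⟨hk, rfl⟩)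

end Matchings

section Exchange

variable {V : Type*} [LinearOrder V] {K L : Finset V} {σ τ ρ : V → V} {a b c d i k t : V}

theorem comp_swap_apply : (σ ∘ Equiv.swap a b) k = if k = a then σ b else if k = b then σ a
    else σ k := by
  rw [Function.comp_apply, Equiv.swap_apply_def]
  split_ifs <;> rfl

theorem comp_swap_comp_swap : (σ ∘ Equiv.swap a b) ∘ Equiv.swap a b = σ := by
  funext k
  simp

theorem IsArcMap.comp_swap (h : IsArcMap K L σ) (ha : a ∈ K) (hb : b ∈ K) (hab : σ a < b)
    (hba : σ b < a) : IsArcMap K L (σ ∘ Equiv.swap a b) where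
  bijOn := h.bijOn.comp (Equiv.bijOn_swap ha hb)
  lt k hk := by
    have := h.lt k hk
    rw [comp_swap_apply]
    grind
  eq_self k hk := by
    have := h.eq_self k hk
    rw [comp_swap_apply]
    grind
  disjoint := h.disjoint

theorem exchange_pair_arcsOf (ha : a ∈ K) (hb : b ∈ K) (hne : a ≠ b) (hab : σ a < b)
    (hba : σ b < a) :
    exchange (arcsOf K σ) {(σ a, a), (σ b, b)} {(σ a, b), (σ b, a)} =
      some (arcsOf K (σ ∘ Equiv.swap a b)) := by
  rw [exchange, if_pos (by simp [hab, hba]), Option.some_inj]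
  ext ⟨x, k⟩
  simp only [Finset.mem_union, Finset.mem_sdiff, Finset.mem_insert, Finset.mem_singleton,
    mem_arcsOf, Prod.mk.injEq, comp_swap_apply]
  grind

theorem exchange_triple_arcsOf (ha : a ∈ K) (hb : b ∈ K) (hc : c ∈ K) (hab : a ≠ b)
    (hac : a ≠ c) (hbc : b ≠ c) (hlt₁ : σ a < b) (hlt₂ : σ b < c) (hlt₃ : σ c < a) :
    exchange (arcsOf K σ) {(σ a, a), (σ b, b), (σ c, c)} {(σ a, b), (σ b, c), (σ c, a)} =
      some (arcsOf K ((σ ∘ Equiv.swap a b) ∘ Equiv.swap a c)) := by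
  rw [exchange, if_pos (by simp [hlt₁, hlt₂, hlt₃]), Option.some_inj]
  ext ⟨x, k⟩
  simp only [Finset.mem_union, Finset.mem_sdiff, Finset.mem_insert, Finset.mem_singleton,
    mem_arcsOf, Prod.mk.injEq, comp_swap_apply]
  grind

/-- The matchings of `σ` and `τ` differ only by a rearrangement of arcs starting before `d`. -/
def AgreeFrom (K : Finset V) (d : V) (σ τ : V → V) : Prop :=
  ∀ k ∈ K, σ k = τ k ∨ σ k < d ∧ τ k < d

namespace AgreeFrom

theorem refl (K : Finset V) (d : V) (σ : V → V) : AgreeFrom K d σ σ := fun _ _ => .inl rfl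

theorem trans (h : AgreeFrom K d σ τ) (h' : AgreeFrom K d τ ρ) : AgreeFrom K d σ ρ := by
  intro k hk
  have := h k hk
  have := h' k hk
  grind

theorem lt_iff (h : AgreeFrom K d σ τ) (hk : k ∈ K) : σ k < d ↔ τ k < d := by
  have := h k hk
  grind

theorem eq_of_le (h : AgreeFrom K d σ τ) (hk : k ∈ K) (hd : d ≤ τ k) : σ k = τ k := by
  have := h k hk
  grind

theorem comp_swap (ha : σ a < d) (hb : σ b < d) : AgreeFrom K d (σ ∘ Equiv.swap a b) σ := by
  intro k _
  rw [comp_swap_apply]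
  grind

end AgreeFrom

/-- Among the arcs of `σ` to the right of `k`, the first large one ends at `t`. -/
structure IsNextLarge (K : Finset V) (i : V) (σ : V → V) (k t : V) : Prop where
  mem : t ∈ K
  large : σ t < i
  lt : k < t
  le : ∀ u ∈ K, k < u → σ u < i → t ≤ u

theorem exists_isNextLarge (h : ∃ t ∈ K, k < t ∧ σ t < i) : ∃ t, IsNextLarge K i σ k t := by
  obtain ⟨t, ht, hmin⟩ := Finset.exists_min_image (K.filter fun t => k < t ∧ σ t < i) id
    (Finset.filter_nonempty_iff.2 h)
  simp only [Finset.mem_filter, id] at ht hmin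
  exact ⟨t, ht.1, ht.2.2, ht.2.1, fun u hu hku hui => hmin u ⟨hu, hku, hui⟩⟩

theorem IsNextLarge.isLeast (h : IsNextLarge K i σ k t) :
    IsLeast (K.filter fun t => σ t < i ∧ k < t : Set V) t := by
  refine ⟨by simp [h.mem, h.large, h.lt], fun u hu => ?_⟩
  simp only [Finset.coe_filter, Set.mem_ofPred_eq] at hu
  exact h.le u hu.1 hu.2.2 hu.2.1

theorem IsNextLarge.nextLarge_arcsOf (h : IsNextLarge K i σ k t) :
    nextLarge (arcsOf K σ) i k = some t := by
  rw [nextLarge, rights_filter_arcsOf]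
  exact minOpt_eq_some_iff.2 h.isLeast

/-- Make the arc at `k` large, by exchanging it if necessary with the next large arc to the
right. -/
def borrowMap (K : Finset V) (i : V) (σ : V → V) (k : V) : V → V :=
  if σ k < i then σ else
    match minOpt (K.filter fun t => σ t < i ∧ k < t) with
    | none => σ
    | some t => σ ∘ Equiv.swap k t

/-- Undo `borrowMap` at `k`: the first arc to the right of `k` which starts before `d` is small
only if it came from `k`. -/
def repay (K : Finset V) (i d : V) (σ : V → V) (k : V) : V → V :=
  match minOpt (K.filter fun t => k < t ∧ σ t < d) with
  | none => σ
  | some t => if σ t < i then σ else σ ∘ Equiv.swap k t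

/-- The first of the arcs of `σ` which end in `s` and start before `d` is large. -/
def LargeFirst (s : Finset V) (i d : V) (σ : V → V) : Prop :=
  ∀ k ∈ s, σ k < d → ∃ k' ∈ s, k' ≤ k ∧ σ k' < i

theorem borrowMap_of_large (h : σ k < i) : borrowMap K i σ k = σ := if_pos h

theorem IsNextLarge.borrowMap_eq (h : IsNextLarge K i σ k t) (hk : ¬ σ k < i) :
    borrowMap K i σ k = σ ∘ Equiv.swap k t := by
  rw [borrowMap, if_neg hk, minOpt_eq_some_iff.2 h.isLeast]

theorem repay_borrowMap (hid : i ≤ d) (hkd : σ k < d)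
    (hlarge : ¬ σ k < i → ∃ t ∈ K, k < t ∧ σ t < i)
    (hfirst : LargeFirst (K.filter (k < ·)) i d σ) :
    repay K i d (borrowMap K i σ k) k = σ := by
  by_cases hk : σ k < i
  · rw [borrowMap_of_large hk, repay]
    split
    · rfl
    next t ht =>
      obtain ⟨htK, hmin⟩ := minOpt_eq_some_iff.1 ht
      obtain ⟨hkt, htd⟩ := (Finset.mem_filter.1 htK).2
      obtain ⟨u, hu, hut, hui⟩ := hfirst t (by grind) htd
      obtain rfl : u = t := le_antisymm hut (hmin (by grind))
      exact if_pos hui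
  · obtain ⟨t, ht⟩ := exists_isNextLarge (hlarge hk)
    have hrepay : IsLeast (K.filter fun u => k < u ∧ (σ ∘ Equiv.swap k t) u < d : Set V) t := by
      have := ht.lt
      refine ⟨by simp [ht.mem, ht.lt, hkd], fun u hu => ?_⟩
      simp only [Finset.coe_filter, Set.mem_ofPred_eq, comp_swap_apply] at hu
      by_contra! hut
      obtain ⟨v, hv, hvu, hvi⟩ := hfirst u (by grind) (by grind)
      have := ht.le v (by grind) (by grind) hvi
      grind
    rw [ht.borrowMap_eq hk, repay, minOpt_eq_some_iff.2 hrepay]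
    simpa [hk] using comp_swap_comp_swap

end Exchange

section Borrowing

variable {V : Type*} [LinearOrder V] {K L : Finset V} {σ τ : V → V} {d i j k m : V}

theorem borrowMap_eq_or :
    borrowMap K i σ k = σ ∨
      ∃ t, IsNextLarge K i σ k t ∧ borrowMap K i σ k = σ ∘ Equiv.swap k t := by
  by_cases hk : σ k < i
  · exact .inl (borrowMap_of_large hk)
  by_cases hlarge : ∃ t ∈ K, k < t ∧ σ t < i
  · obtain ⟨t, ht⟩ := exists_isNextLarge hlarge
    exact .inr ⟨t, ht, ht.borrowMap_eq hk⟩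
  · left
    rw [borrowMap, if_neg hk, Finset.filter_false_of_mem (by grind), minOpt_empty]

theorem borrowMap_self_lt (hlarge : ¬ σ k < i → ∃ t ∈ K, k < t ∧ σ t < i) :
    borrowMap K i σ k k < i := by
  by_cases hk : σ k < i
  · rwa [borrowMap_of_large hk]
  · obtain ⟨t, ht⟩ := exists_isNextLarge (hlarge hk)
    rw [ht.borrowMap_eq hk, comp_swap_apply, if_pos rfl]
    exact ht.large

theorem AgreeFrom.borrowMap (hid : i ≤ d) (hk : σ k < d) :
    AgreeFrom K d (borrowMap K i σ k) σ := by
  obtain h | ⟨t, ht, h⟩ := borrowMap_eq_or (K := K) (i := i) (σ := σ) (k := k) <;> rw [h]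
  · exact .refl K d σ
  · exact .comp_swap hk (ht.large.trans_le hid)

theorem IsArcMap.borrowMap (h : IsArcMap K L σ) (hk : k ∈ K) :
    IsArcMap K L (borrowMap K i σ k) := by
  by_cases hki : σ k < i
  · rwa [borrowMap_of_large hki]
  obtain h' | ⟨t, ht, h'⟩ := borrowMap_eq_or (K := K) (i := i) (σ := σ) (k := k) <;> rw [h']
  · exact h
  · exact h.comp_swap hk ht.mem ((h.lt k hk).trans ht.lt)
      (ht.large.trans_le ((not_lt.1 hki).trans (h.lt k hk).le))

theorem borrow_arcsOf (h : IsArcMap K L σ) (hk : k ∈ K)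
    (hlarge : ¬ σ k < i → ∃ t ∈ K, k < t ∧ σ t < i) :
    borrow (arcsOf K σ) i k = some (arcsOf K (borrowMap K i σ k)) := by
  by_cases hki : σ k < i
  · simp [borrow, leftOf_arcsOf hk, hki, borrowMap_of_large hki]
  · obtain ⟨t, ht⟩ := exists_isNextLarge (hlarge hki)
    have hlt := h.lt k hk
    have := ht.large
    have := ht.lt
    simp [borrow, leftOf_arcsOf hk, leftOf_arcsOf ht.mem, hki, ht.nextLarge_arcsOf,
      ht.borrowMap_eq hki, exchange_pair_arcsOf hk ht.mem ht.lt.ne (hlt.trans ht.lt) (by grind)]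

/-- The vertices of `K` to the right of `i`. -/
abbrev after (K : Finset V) (i : V) : Finset V := K.filter (i < ·)

/-- The matching obtained by borrowing, from right to left, at all vertices between `i` and
`j`. -/
def borrowSweep (K : Finset V) (i : V) (σ : V → V) (j : V) : V → V :=
  sweepLeft (after K i) (borrowMap K i) σ j

/-- The arc of `σ` which ends at `k` is small, and no right-hand endpoint lies below it. -/
def Tight (K : Finset V) (i : V) (σ : V → V) (k : V) : Prop :=
  i < σ k ∧ ∀ k' ∈ K, σ k < k' → k ≤ k'

/-- The state of `borrowSweep` when the vertices from `j` on have been visited. All arcs which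
remain to be moved start before `d`. -/
structure SweepInv (K L : Finset V) (i d : V) (σ : V → V) (j : V) : Prop where
  arcMap : IsArcMap K L σ
  notMem : i ∉ L
  le : i ≤ d
  lt : i < j
  le_of_lt : ∀ k ∈ K, k < j → k ≤ d
  largeFirst : LargeFirst (K.filter (j ≤ ·)) i d σ
  exists_large : ∃ k ∈ K, j ≤ k ∧ σ k < i
  not_tight : ∀ k ∈ K, j ≤ k → k ≤ d → ¬ Tight K i σ k

theorem IsLastBefore.lt_iff_of_after (hm : IsLastBefore (after K i) j m) (hk : k ∈ K) :
    m < k ↔ j ≤ k := by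
  have := hm.lt
  have := (Finset.mem_filter.1 hm.mem).2
  have := hm.le k
  grind

namespace SweepInv

theorem exists_large_after (h : SweepInv K L i d σ j) (hmj : m < j) : ∃ t ∈ K, m < t ∧ σ t < i :=
  let ⟨t, ht, hjt, hti⟩ := h.exists_large
  ⟨t, ht, hmj.trans_le hjt, hti⟩

theorem apply_lt (h : SweepInv K L i d σ j) (hm : m ∈ K) (hmj : m < j) : σ m < d :=
  (h.arcMap.lt m hm).trans_le (h.le_of_lt m hm hmj)

theorem borrowMap (h : SweepInv K L i d σ j) (hm : IsLastBefore (after K i) j m) :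
    SweepInv K L i d (borrowMap K i σ m) m := by
  obtain ⟨hmK, him⟩ := Finset.mem_filter.1 hm.mem
  have hself : ArcDiagram.borrowMap K i σ m m < i :=
    borrowMap_self_lt fun _ => h.exists_large_after hm.lt
  refine ⟨h.arcMap.borrowMap hmK, h.notMem, h.le, him,
    fun k hk hkm => h.le_of_lt k hk (hkm.trans hm.lt),
    fun k hk _ => ⟨m, by simp [hmK], (Finset.mem_filter.1 hk).2, hself⟩,
    ⟨m, hmK, le_rfl, hself⟩, fun k hk hmk hkd => ?_⟩
  obtain rfl | hmk := hmk.eq_or_lt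
  · exact fun htight => lt_asymm hself htight.1
  have hkj := (hm.lt_iff_of_after hk).1 hmk
  obtain heq | ⟨t, -, heq⟩ := borrowMap_eq_or (K := K) (i := i) (σ := σ) (k := m) <;> rw [heq]
  · exact h.not_tight k hk hkj hkd
  by_cases hkt : k = t
  · rintro ⟨-, hbelow⟩
    rw [comp_swap_apply, if_neg hmk.ne', if_pos hkt] at hbelow
    exact (hbelow m hmK (h.arcMap.lt m hmK)).not_gt hmk
  · simpa only [Tight, comp_swap_apply, if_neg hmk.ne', if_neg hkt] using
      h.not_tight k hk hkj hkd

theorem repay_borrowMap (h : SweepInv K L i d σ j) (hm : IsLastBefore (after K i) j m) :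
    repay K i d (ArcDiagram.borrowMap K i σ m) m = σ := by
  have hfilter : K.filter (m < ·) = K.filter (j ≤ ·) :=
    Finset.filter_congr fun k hk => hm.lt_iff_of_after hk
  exact ArcDiagram.repay_borrowMap h.le (h.apply_lt (Finset.mem_filter.1 hm.mem).1 hm.lt)
    (fun _ => h.exists_large_after hm.lt) (hfilter ▸ h.largeFirst)

theorem exists_borrowSweep (h : SweepInv K L i d σ j) :
    (∃ j', (∀ k ∈ after K i, j' ≤ k) ∧ SweepInv K L i d (borrowSweep K i σ j) j') ∧
      AgreeFrom K d (borrowSweep K i σ j) σ := by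
  obtain ⟨j', hj', hinv, hagree⟩ := exists_inv_sweepLeft
    (Inv := fun τ j => SweepInv K L i d τ j ∧ AgreeFrom K d τ σ)
    (fun τ j m hm hτ => ⟨hτ.1.borrowMap hm, .trans
      (.borrowMap hτ.1.le (hτ.1.apply_lt (Finset.mem_filter.1 hm.mem).1 hm.lt)) hτ.2⟩)
    ⟨h, .refl K d σ⟩
  exact ⟨⟨j', hj', hinv⟩, hagree⟩

theorem agreeFrom_borrowSweep (h : SweepInv K L i d σ j) :
    AgreeFrom K d (borrowSweep K i σ j) σ := h.exists_borrowSweep.2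

theorem isArcMap_borrowSweep (h : SweepInv K L i d σ j) :
    IsArcMap K L (borrowSweep K i σ j) :=
  let ⟨⟨_, _, hinv⟩, _⟩ := h.exists_borrowSweep
  hinv.arcMap

theorem exists_borrowSweep_lt (h : SweepInv K L i d σ j) :
    ∃ k ∈ K, i < k ∧ borrowSweep K i σ j k < i :=
  let ⟨⟨_, _, hinv⟩, _⟩ := h.exists_borrowSweep
  let ⟨k, hk, hjk, hki⟩ := hinv.exists_large
  ⟨k, hk, hinv.lt.trans_le hjk, hki⟩

theorem not_tight_borrowSweep (h : SweepInv K L i d σ j) (hk : k ∈ K) (hkd : k ≤ d) :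
    ¬ Tight K i (borrowSweep K i σ j) k := by
  obtain ⟨⟨j', hj', hinv⟩, -⟩ := h.exists_borrowSweep
  intro htight
  have hik : i < k := htight.1.trans (hinv.arcMap.lt k hk)
  exact hinv.not_tight k hk (hj' k (Finset.mem_filter.2 ⟨hk, hik⟩)) hkd htight

theorem eq_of_borrowSweep_eq (hσ : SweepInv K L i d σ j) (hτ : SweepInv K L i d τ j)
    (heq : borrowSweep K i σ j = borrowSweep K i τ j) : σ = τ := by
  refine eq_of_sweepLeft_eq (Inv := SweepInv K L i d) (fun _ _ _ hm h => h.borrowMap hm) ?_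
    hσ hτ heq
  intro σ τ j m hm hσ hτ heq
  rw [← hσ.repay_borrowMap hm, heq, hτ.repay_borrowMap hm]

theorem stepII_arcsOf (h : SweepInv K L i d σ j) (hj : j ∈ K) (hji : σ j < i)
    (hm : IsLastBefore (after K i) j m) :
    stepII i (arcsOf K σ, j) m = some (arcsOf K (ArcDiagram.borrowMap K i σ m), m) := by
  obtain ⟨hmK, him⟩ := Finset.mem_filter.1 hm.mem
  by_cases hmi : σ m < i
  · simp [stepII, leftOf_arcsOf hmK, leftOf_arcsOf hj, hmi, borrowMap_of_large hmi]
  · have hnext : IsNextLarge K i σ m j :=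
      ⟨hj, hji, hm.lt, fun u hu hmu _ => (hm.lt_iff_of_after hu).1 hmu⟩
    have hσm : σ m < j := (h.arcMap.lt m hmK).trans hm.lt
    simp [stepII, leftOf_arcsOf hmK, leftOf_arcsOf hj, hmi, hnext.borrowMap_eq hmi,
      exchange_pair_arcsOf hj hmK hm.lt.ne' (hji.trans him) hσm, Equiv.swap_comm]

theorem exists_foldlM_stepII (h : SweepInv K L i d σ j) (hj : j ∈ K) (hji : σ j < i) :
    ∃ p, (leftwards (after K i) j).foldlM (stepII i) (arcsOf K σ, j) =
      some (arcsOf K (borrowSweep K i σ j), p) := by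
  refine exists_foldlM_leftwards_eq_some (Inv := fun τ j => SweepInv K L i d τ j ∧ j ∈ K ∧ τ j < i)
    (fun τ j => (arcsOf K τ, j)) ?_ ?_ ⟨h, hj, hji⟩
  · rintro τ j m hm ⟨hτ, -, -⟩
    exact ⟨hτ.borrowMap hm, (Finset.mem_filter.1 hm.mem).1,
      borrowMap_self_lt fun _ => hτ.exists_large_after hm.lt⟩
  · rintro τ j m hm ⟨hτ, hj, hji⟩
    exact hτ.stepII_arcsOf hj hji hm

end SweepInv

end Borrowing

section Rotation

variable {V : Type*} [LinearOrder V] {K L : Finset V} {σ τ : V → V} {d f i j k m p t : V}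
  {st st' : (V → V) × V}

/-- `d < f` are consecutive right-hand endpoints to the right of `i`, or `d = i` and `f` is the
first right-hand endpoint to the right of `i`. -/
structure Gap (K L : Finset V) (i d f : V) : Prop where
  le : i ≤ d
  lt : d < f
  mem : f ∈ K
  eq_or_mem : d = i ∨ d ∈ K
  consecutive : ∀ k ∈ K, k < f → k ≤ d
  left_notMem : i ∉ L
  lower_notMem : d ∉ L
  upper_notMem : f ∉ L

/-- A step of Algorithm I, where the arc at the pointer `st.2` starts between `d` and `f`. The
cases are (B2.2), (B2.1), and (B1) together with (B2.3). -/
def rotateStep (K : Finset V) (i d f : V) (st : (V → V) × V) (m : V) : (V → V) × V :=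
  if f < st.1 m then st
  else if d < st.1 m then (st.1, m)
  else (borrowMap K i (st.1 ∘ Equiv.swap st.2 m) st.2, m)

/-- Undo `rotateStep` at `m`: if the pointer has moved to `m`, then it came from the first arc to
the right of `m` which starts before `f`. -/
def rotateBack (K : Finset V) (i d f : V) (st : (V → V) × V) (m : V) : (V → V) × V :=
  if st.2 = m then
    match minOpt (K.filter fun k => m < k ∧ st.1 k < f) with
    | none => st
    | some p => if d < st.1 p then (st.1, p) else (repay K i d st.1 p ∘ Equiv.swap p m, p)
  else st

/-- The state of Algorithm I when the vertices from `j` on have been visited, with the pointer at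
`st.2`. -/
structure RotateInv (K L : Finset V) (i d f : V) (st : (V → V) × V) (j : V) : Prop where
  arcMap : IsArcMap K L st.1
  mem : st.2 ∈ K
  le : j ≤ st.2
  upper_le : f ≤ j
  lower_lt : d < st.1 st.2
  lt_upper : st.1 st.2 < f
  between : ∀ k ∈ K, j ≤ k → k < st.2 → f < st.1 k
  largeFirst : LargeFirst (K.filter (st.2 < ·)) i d st.1
  exists_large : ∃ r ∈ K, f ≤ r ∧ st.1 r < i ∧ ∀ k ∈ K, k < j → st.1 k < d → k ≤ r

theorem IsLastBefore.lt_iff_of_from (hm : IsLastBefore (K.filter (f ≤ ·)) j m) (hk : k ∈ K) :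
    m < k ↔ j ≤ k := by
  have := hm.lt
  have := (Finset.mem_filter.1 hm.mem).2
  have := hm.le k
  grind

theorem IsNextLarge.comp_swap (hmk : m < k) (h : IsNextLarge K i σ k t) :
    IsNextLarge K i (σ ∘ Equiv.swap k m) k t := by
  have happly : ∀ u, k < u → (σ ∘ Equiv.swap k m) u = σ u := fun u hu => by
    rw [comp_swap_apply, if_neg hu.ne', if_neg (hmk.trans hu).ne']
  exact ⟨h.mem, (happly t h.lt).trans_lt h.large, h.lt,
    fun u hu hku hui => h.le u hu hku (happly u hku ▸ hui)⟩

namespace RotateInv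

section Step

variable (g : Gap K L i d f) (h : RotateInv K L i d f st j)
  (hm : IsLastBefore (K.filter (f ≤ ·)) j m)
include h hm

theorem lt_pointer : m < st.2 := hm.lt.trans_le h.le

theorem isArcMap_comp_swap (hmd : st.1 m ≤ d) : IsArcMap K L (st.1 ∘ Equiv.swap st.2 m) := by
  obtain ⟨hmK, hfm⟩ := Finset.mem_filter.1 hm.mem
  exact h.arcMap.comp_swap h.mem hmK (h.lt_upper.trans_le hfm)
    ((hmd.trans_lt h.lower_lt).trans (h.arcMap.lt _ h.mem))

include g

theorem apply_lt_lower (hmd : ¬ d < st.1 m) : st.1 m < d :=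
  (not_lt.1 hmd).lt_of_ne (h.arcMap.ne g.lower_notMem (Finset.mem_filter.1 hm.mem).1)

theorem exists_large_after_pointer (hmd : ¬ d < st.1 m) (hmi : ¬ st.1 m < i) :
    ∃ t ∈ K, st.2 < t ∧ st.1 t < i := by
  obtain ⟨r, hr, -, hri, hlast⟩ := h.exists_large
  have hmr : m ≤ r :=
    hlast m (Finset.mem_filter.1 hm.mem).1 hm.lt (h.apply_lt_lower g hm hmd)
  have hjr : j ≤ r := (hm.lt_iff_of_from hr).1 (hmr.lt_of_ne (by grind))
  have := h.between r hr hjr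
  have := h.lower_lt
  have := g.le
  have := g.lt
  exact ⟨r, hr, by grind, hri⟩

theorem exists_large_comp_swap (hmd : ¬ d < st.1 m)
    (hmi : ¬ (st.1 ∘ Equiv.swap st.2 m) st.2 < i) :
    ∃ t ∈ K, st.2 < t ∧ (st.1 ∘ Equiv.swap st.2 m) t < i := by
  have hlt := h.lt_pointer hm
  simp only [comp_swap_apply] at hmi ⊢
  obtain ⟨t, ht, hpt, hti⟩ := h.exists_large_after_pointer g hm hmd (by simpa using hmi)
  exact ⟨t, ht, hpt, by rwa [if_neg hpt.ne', if_neg (hlt.trans hpt).ne']⟩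

theorem agreeFrom_rotateStep : AgreeFrom K f (rotateStep K i d f st m).1 st.1 := by
  rw [rotateStep]
  split_ifs with hf hd
  · exact .refl K f st.1
  · exact .refl K f st.1
  · have hmf : st.1 m < f := (h.apply_lt_lower g hm hd).trans g.lt
    refine .trans (.borrowMap (g.le.trans g.lt.le) ?_) (.comp_swap h.lt_upper hmf)
    simpa using hmf

theorem exchange (hd : ¬ d < st.1 m) :
    RotateInv K L i d f (borrowMap K i (st.1 ∘ Equiv.swap st.2 m) st.2, m) m := by
  obtain ⟨hmK, hfm⟩ := Finset.mem_filter.1 hm.mem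
  have hmp := h.lt_pointer hm
  have hmd := h.apply_lt_lower g hm hd
  have hagree := h.agreeFrom_rotateStep g hm
  rw [rotateStep, if_neg (hmd.trans g.lt).not_gt, if_neg hd] at hagree
  have hlarge := borrowMap_self_lt (h.exists_large_comp_swap g hm hd)
  have hself : borrowMap K i (st.1 ∘ Equiv.swap st.2 m) st.2 m = st.1 st.2 := by
    have hagree : AgreeFrom K d (borrowMap K i (st.1 ∘ Equiv.swap st.2 m) st.2) _ :=
      .borrowMap g.le (by simpa using hmd)
    simpa using hagree.eq_of_le hmK (by simpa using h.lower_lt.le)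
  refine ⟨(h.isArcMap_comp_swap hm hmd.le).borrowMap h.mem, hmK, le_rfl, hfm,
    h.lower_lt.trans_eq hself.symm, hself.trans_lt h.lt_upper,
    fun k _ hmk hkm => absurd hkm hmk.not_gt, fun k hk hkd => ?_,
    st.2, h.mem, hfm.trans hmp.le, hlarge, fun k _ hkm _ => (hkm.trans hmp).le⟩
  obtain ⟨hkK, hmk⟩ := Finset.mem_filter.1 hk
  refine ⟨st.2, Finset.mem_filter.2 ⟨h.mem, hmp⟩, not_lt.1 fun hkp => ?_, hlarge⟩
  have := h.between k hkK ((hm.lt_iff_of_from hkK).1 hmk) hkp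
  exact this.not_gt ((hagree.lt_iff hkK).1 (hkd.trans g.lt))

theorem rotateStep : RotateInv K L i d f (rotateStep K i d f st m) m := by
  obtain ⟨hmK, hfm⟩ := Finset.mem_filter.1 hm.mem
  obtain ⟨r, hr, hfr, hri, hlast⟩ := h.exists_large
  have hlast' : ∀ k ∈ K, k < m → st.1 k < d → k ≤ r := fun k hk hkm =>
    hlast k hk (hkm.trans hm.lt)
  rw [ArcDiagram.rotateStep]
  split_ifs with hf hd
  · refine ⟨h.arcMap, h.mem, (h.lt_pointer hm).le, hfm, h.lower_lt, h.lt_upper,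
      fun k hk hmk hkp => ?_, h.largeFirst, r, hr, hfr, hri, hlast'⟩
    obtain rfl | hmk := hmk.eq_or_lt
    · exact hf
    · exact h.between k hk ((hm.lt_iff_of_from hk).1 hmk) hkp
  · have hmf : st.1 m < f := (not_lt.1 hf).lt_of_ne (h.arcMap.ne g.upper_notMem hmK)
    refine ⟨h.arcMap, hmK, le_rfl, hfm, hd, hmf, fun k _ hmk hkm => absurd hkm hmk.not_gt,
      fun k hk hkd => ?_, r, hr, hfr, hri, hlast'⟩
    obtain ⟨hkK, hmk⟩ := Finset.mem_filter.1 hk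
    have hpk : st.2 ≤ k := not_lt.1 fun hkp =>
      (h.between k hkK ((hm.lt_iff_of_from hkK).1 hmk) hkp).not_gt (lt_trans hkd g.lt)
    have hne : st.2 ≠ k := fun heq => h.lower_lt.not_gt (heq ▸ hkd)
    obtain ⟨k', hk', hle, hki⟩ := h.largeFirst k
      (Finset.mem_filter.2 ⟨hkK, hpk.lt_of_ne hne⟩) hkd
    obtain ⟨hkK', hpk'⟩ := Finset.mem_filter.1 hk'
    exact ⟨k', Finset.mem_filter.2 ⟨hkK', (h.lt_pointer hm).trans hpk'⟩, hle, hki⟩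
  · exact h.exchange g hm hd

omit g in
theorem isLeast_pointer (hagree : AgreeFrom K f τ st.1) :
    IsLeast (K.filter fun k => m < k ∧ τ k < f : Set V) st.2 := by
  refine ⟨?_, fun k hk => ?_⟩
  · simp [h.mem, h.lt_pointer hm, (hagree.lt_iff h.mem).2 h.lt_upper]
  · simp only [Finset.coe_filter, Set.mem_ofPred_eq] at hk
    obtain ⟨hkK, hmk, hkf⟩ := hk
    by_contra! hkp
    exact (h.between k hkK ((hm.lt_iff_of_from hkK).1 hmk) hkp).not_gt
      ((hagree.lt_iff hkK).1 hkf)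

theorem rotateBack_rotateStep :
    rotateBack K i d f (ArcDiagram.rotateStep K i d f st m) m = st := by
  have hmin := minOpt_eq_some_iff.2 (h.isLeast_pointer hm (h.agreeFrom_rotateStep g hm))
  rw [ArcDiagram.rotateStep] at hmin ⊢
  split_ifs at hmin ⊢ with hf hd
  · exact if_neg (h.lt_pointer hm).ne'
  · rw [rotateBack, if_pos rfl, hmin]
    exact if_pos h.lower_lt
  · have hself := borrowMap_self_lt (h.exists_large_comp_swap g hm hd)
    have hrepay := repay_borrowMap (K := K) (σ := st.1 ∘ Equiv.swap st.2 m) (k := st.2) g.le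
      (by simpa using h.apply_lt_lower g hm hd) (h.exists_large_comp_swap g hm hd)
    rw [rotateBack, if_pos rfl, hmin]
    simp only [if_neg (hself.trans_le g.le).not_gt]
    rw [hrepay, comp_swap_comp_swap]
    intro k hk hkd
    have hmp := h.lt_pointer hm
    have happly : ∀ u ∈ K.filter (st.2 < ·), (st.1 ∘ Equiv.swap st.2 m) u = st.1 u := by
      intro u hu
      rw [comp_swap_apply]
      grind
    obtain ⟨k', hk', hle, hki⟩ := h.largeFirst k hk (happly k hk ▸ hkd)
    exact ⟨k', hk', hle, (happly k' hk').symm ▸ hki⟩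

theorem hasRightBetween_iff (hmi : ¬ st.1 m < i) :
    HasRightBetween (arcsOf K st.1) (st.1 st.2) (st.1 m) ↔ f < st.1 m ∨ st.1 m < d := by
  have hmK := (Finset.mem_filter.1 hm.mem).1
  have := h.arcMap.ne g.upper_notMem hmK
  have := h.lower_lt
  have := h.lt_upper
  simp only [HasRightBetween, rights_arcsOf]
  constructor
  · rintro ⟨k, hk, hk₁, hk₂⟩
    have := g.consecutive k hk
    grind
  · rintro (hf | hd)
    · exact ⟨f, g.mem, by grind, by grind⟩
    · exact ⟨d, by have := g.eq_or_mem; grind, by grind, by grind⟩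

theorem stepI_arcsOf :
    stepI i (arcsOf K st.1, st.2) m =
      some (arcsOf K (ArcDiagram.rotateStep K i d f st m).1,
        (ArcDiagram.rotateStep K i d f st m).2) := by
  obtain ⟨hmK, hfm⟩ := Finset.mem_filter.1 hm.mem
  have hne := (h.lt_pointer hm).ne'
  have hpm : st.1 st.2 < m := h.lt_upper.trans_le hfm
  have hlower := h.lower_lt
  have hupper := h.lt_upper
  have hp := h.arcMap.lt _ h.mem
  have hid := g.le
  have hbetween := h.hasRightBetween_iff g hm
  rw [ArcDiagram.rotateStep]
  split_ifs with hf hd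
  · have hmi : ¬ st.1 m < i := by grind
    simp [stepI, leftOf_arcsOf hmK, leftOf_arcsOf h.mem, hmi, hbetween hmi, hf, hupper.trans hf]
  · have hmi : ¬ st.1 m < i := by grind
    simp [stepI, leftOf_arcsOf hmK, leftOf_arcsOf h.mem, hmi, hbetween hmi, hf, hd.not_gt]
  have hmp : st.1 m < st.2 := by grind
  by_cases hmi : st.1 m < i
  · rw [borrowMap_of_large (by simpa using hmi)]
    simp [stepI, leftOf_arcsOf hmK, leftOf_arcsOf h.mem, hmi,
      exchange_pair_arcsOf h.mem hmK hne hpm hmp]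
  · obtain ⟨t, ht⟩ := exists_isNextLarge (h.exists_large_after_pointer g hm hd hmi)
    have hpt := ht.lt
    have hti := ht.large
    rw [(ht.comp_swap (h.lt_pointer hm)).borrowMap_eq (by simpa using hmi)]
    have hmd := h.apply_lt_lower g hm hd
    simp [stepI, leftOf_arcsOf hmK, leftOf_arcsOf h.mem, leftOf_arcsOf ht.mem, hmi,
      hbetween hmi, hmd, (hmd.trans hlower).not_gt, ht.nextLarge_arcsOf,
      exchange_triple_arcsOf h.mem hmK ht.mem hne hpt.ne (by grind) hpm (by grind) (by grind)]

end Step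

end RotateInv

/-- Algorithm I on the vertices from `f` on, with the second pointer starting at `j`. -/
def rotate (K : Finset V) (i d f : V) (st : (V → V) × V) (j : V) : (V → V) × V :=
  sweepLeft (K.filter (f ≤ ·)) (rotateStep K i d f) st j

namespace RotateInv

section

variable (g : Gap K L i d f) (h : RotateInv K L i d f st j)
include g h

theorem exists_rotate :
    RotateInv K L i d f (rotate K i d f st j) f ∧
      AgreeFrom K f (rotate K i d f st j).1 st.1 := by
  obtain ⟨j', hj', hinv, hagree⟩ := exists_inv_sweepLeft
    (Inv := fun st' j => RotateInv K L i d f st' j ∧ AgreeFrom K f st'.1 st.1)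
    (fun st' j m hm hst' => ⟨hst'.1.rotateStep g hm, .trans
      (hst'.1.agreeFrom_rotateStep g hm) hst'.2⟩)
    ⟨h, .refl K f st.1⟩
  obtain rfl : j' = f := (hj' f (by simp [g.mem])).antisymm hinv.upper_le
  exact ⟨hinv, hagree⟩

theorem rotate : RotateInv K L i d f (rotate K i d f st j) f := (h.exists_rotate g).1

theorem agreeFrom_rotate : AgreeFrom K f (ArcDiagram.rotate K i d f st j).1 st.1 :=
  (h.exists_rotate g).2

theorem rotate_snd : (ArcDiagram.rotate K i d f st j).2 = f := by
  have hinv := h.rotate g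
  refine (hinv.le.antisymm (not_lt.1 fun hlt => ?_)).symm
  exact (hinv.between f g.mem le_rfl hlt).not_gt (hinv.arcMap.lt f g.mem)

theorem eq_of_rotate_eq (h' : RotateInv K L i d f st' j)
    (heq : ArcDiagram.rotate K i d f st j = ArcDiagram.rotate K i d f st' j) : st = st' := by
  refine eq_of_sweepLeft_eq (Inv := RotateInv K L i d f) (fun _ _ _ hm h => h.rotateStep g hm) ?_
    h h' heq
  intro st st' j m hm h h' heq
  rw [← h.rotateBack_rotateStep g hm, heq, h'.rotateBack_rotateStep g hm]

theorem foldlM_stepI :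
    (leftwards (K.filter (f ≤ ·)) j).foldlM (stepI i) (arcsOf K st.1, st.2) =
      some (arcsOf K (ArcDiagram.rotate K i d f st j).1, (ArcDiagram.rotate K i d f st j).2) :=
  (exists_foldlM_leftwards_eq_some (Inv := RotateInv K L i d f)
    (fun st _ => (arcsOf K st.1, st.2)) (fun _ _ _ hm h => h.rotateStep g hm)
    (fun _ _ _ hm h => h.stepI_arcsOf g hm) h).choose_spec

end

end RotateInv

/-- Arcs starting after `f` are ignored and, at an arc starting in the gap, the pointer is
forgotten. -/
theorem rotate_eq_of_forall_lt (hk : k ∈ K) (hfk : f ≤ k) (hkj : k < j) (hdk : d < σ k)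
    (hkf : σ k < f) (hlower : ∀ u ∈ K, k ≤ u → d < σ u) :
    rotate K i d f (σ, p) j = rotate K i d f (σ, k) k := by
  induction j using leftwards_induction (K.filter (f ≤ ·)) generalizing p with
  | base j hj => exact absurd hkj (hj k (by simp [hk, hfk])).not_gt
  | step j m hm ih =>
    rw [rotate, hm.sweepLeft_eq, ← rotate]
    obtain rfl | hkm := (hm.le k (by simp [hk, hfk]) hkj).eq_or_lt
    · rw [rotateStep, if_neg hkf.not_gt, if_pos hdk]
    · have := hlower m (Finset.mem_filter.1 hm.mem).1 hkm.le
      rw [rotateStep]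
      split_ifs
      · exact ih hkm
      · exact ih hkm

end Rotation

section Outcomes

variable {V : Type*} [LinearOrder V] {K L : Finset V} {σ τ ω : V → V}
  {c c' d d' f f' i k : V}

theorem AgreeFrom.mono (hdf : d ≤ f) (h : AgreeFrom K d σ τ) : AgreeFrom K f σ τ :=
  fun k hk => (h k hk).imp_right fun ⟨hσ, hτ⟩ => ⟨hσ.trans_le hdf, hτ.trans_le hdf⟩

/-- There is a critical large arc, it ends at `d`, and there is no critical small arc. -/
structure IsClosedAt (K : Finset V) (i : V) (σ : V → V) (d : V) : Prop where
  mem : d ∈ K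
  lt : i < d
  large : σ d < i
  closed : ∀ k ∈ K, σ k < d → k ≤ d

/-- The critical small arc exists and starts between `d` and `f`. As `c` depends only on the arcs
starting before `f`, it can be read off the outcome, unlike the endpoint of the critical small
arc. -/
structure IsCrossingAt (K L : Finset V) (i : V) (σ : V → V) (d f c : V) : Prop where
  gap : Gap K L i d f
  le_of_lt : ∀ k ∈ K, σ k < f → k ≤ c
  rotateInv : RotateInv K L i d f (σ, c) c

/-- The outcome of Algorithms I and II if there are both critical arcs. -/
def crossingMap (K : Finset V) (i : V) (σ : V → V) (d f c : V) : V → V :=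
  borrowSweep K i (rotate K i d f (σ, c) c).1 f

/-- Algorithms I and II turn the matching of `σ` into that of `ω`. -/
inductive Outcome (K L : Finset V) (i : V) (σ ω : V → V) : Prop
  | noLarge (h : ∀ k ∈ K, i < k → i ≤ σ k) (hω : ω = σ)
  | closed (d : V) (h : IsClosedAt K i σ d) (hω : ω = borrowSweep K i σ d)
  | crossing (d f c : V) (h : IsCrossingAt K L i σ d f c) (hω : ω = crossingMap K i σ d f c)

theorem IsClosedAt.sweepInv (hd : IsClosedAt K i σ d) (h : IsArcMap K L σ) (hi : i ∉ L) :
    SweepInv K L i d σ d where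
  arcMap := h
  notMem := hi
  le := hd.lt.le
  lt := hd.lt
  le_of_lt _ _ hkd := hkd.le
  largeFirst k hk _ := ⟨d, by simp [hd.mem], (Finset.mem_filter.1 hk).2, hd.large⟩
  exists_large := ⟨d, hd.mem, le_rfl, hd.large⟩
  not_tight k _ hdk hkd htight := (hdk.antisymm hkd ▸ htight.1).not_gt hd.large

theorem RotateInv.sweepInv {st : (V → V) × V} (g : Gap K L i d f)
    (h : RotateInv K L i d f st f) (hst : st.2 = f) : SweepInv K L i d st.1 f where
  arcMap := h.arcMap
  notMem := g.left_notMem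
  le := g.le
  lt := g.le.trans_lt g.lt
  le_of_lt := g.consecutive
  largeFirst k hk hkd := by
    obtain ⟨hkK, hfk⟩ := Finset.mem_filter.1 hk
    have hne : f ≠ k := by
      rintro rfl
      exact hkd.not_gt (hst ▸ h.lower_lt)
    obtain ⟨k', hk', hle, hki⟩ := h.largeFirst k (by simp [hkK, hst, hfk.lt_of_ne hne]) hkd
    obtain ⟨hkK', hfk'⟩ := Finset.mem_filter.1 hk'
    exact ⟨k', Finset.mem_filter.2 ⟨hkK', hst ▸ hfk'.le⟩, hle, hki⟩
  exists_large :=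
    let ⟨r, hr, hfr, hri, _⟩ := h.exists_large
    ⟨r, hr, hfr, hri⟩
  not_tight _ _ hfk hkd := absurd (hfk.trans hkd) g.lt.not_ge

theorem Gap.lower_le (g : Gap K L i d f) (g' : Gap K L i d' f) : d ≤ d' := by
  obtain rfl | hd := g.eq_or_mem
  · exact g'.le
  · exact g'.consecutive d hd g.lt

theorem IsClosedAt.le_of_borrowSweep_lt (hd : IsClosedAt K i σ d) (h : IsArcMap K L σ)
    (hi : i ∉ L) (hk : k ∈ K) (hkd : borrowSweep K i σ d k < d) : k ≤ d :=
  hd.closed k hk (((hd.sweepInv h hi).agreeFrom_borrowSweep.lt_iff hk).1 hkd)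

/-- The first right-hand endpoint after `d` is tight. -/
theorem exists_tight_of_closed (h : IsArcMap K L ω) (hi : i ∉ L) (hid : i ≤ d)
    (hclosed : ∀ k ∈ K, ω k < d → k ≤ d) (hk : k ∈ K) (hdk : d < k) :
    ∃ m ∈ K, m ≤ k ∧ Tight K i ω m := by
  obtain ⟨m, hm, hmin⟩ := Finset.exists_min_image (K.filter (d < ·)) id
    ⟨k, Finset.mem_filter.2 ⟨hk, hdk⟩⟩
  obtain ⟨hmK, hdm⟩ := Finset.mem_filter.1 hm
  have hdω : d ≤ ω m := not_lt.1 fun hlt => (hclosed m hmK hlt).not_gt hdm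
  refine ⟨m, hmK, hmin k (by simp [hk, hdk]), (hid.trans hdω).lt_of_ne (h.ne hi hmK).symm, ?_⟩
  exact fun k' hk' hlt => hmin k' (Finset.mem_filter.2 ⟨hk', hdω.trans_lt hlt⟩)

theorem le_of_closed_of_not_tight (h : IsArcMap K L ω) (hi : i ∉ L) (hid : i ≤ d)
    (hclosed : ∀ k ∈ K, ω k < d → k ≤ d) (hd' : d' ∈ K)
    (hnot : ∀ k ∈ K, k ≤ d' → ¬ Tight K i ω k) : d' ≤ d := by
  by_contra! hlt
  obtain ⟨m, hm, hle, htight⟩ := exists_tight_of_closed h hi hid hclosed hd' hlt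
  exact hnot m hm hle htight

namespace IsCrossingAt

variable (h : IsCrossingAt K L i σ d f c)
include h

theorem sweepInv : SweepInv K L i d (rotate K i d f (σ, c) c).1 f :=
  (h.rotateInv.rotate h.gap).sweepInv h.gap (h.rotateInv.rotate_snd h.gap)

theorem isArcMap : IsArcMap K L (crossingMap K i σ d f c) := h.sweepInv.isArcMap_borrowSweep

theorem exists_lt : ∃ k ∈ K, i < k ∧ crossingMap K i σ d f c k < i :=
  h.sweepInv.exists_borrowSweep_lt

theorem agreeFrom : AgreeFrom K f (crossingMap K i σ d f c) σ :=
  (h.sweepInv.agreeFrom_borrowSweep.mono h.gap.lt.le).trans (h.rotateInv.agreeFrom_rotate h.gap)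

theorem tight : Tight K i (crossingMap K i σ d f c) f := by
  have hlower := (h.rotateInv.rotate h.gap).lower_lt
  rw [h.rotateInv.rotate_snd h.gap] at hlower
  rw [Tight, crossingMap, h.sweepInv.agreeFrom_borrowSweep.eq_of_le h.gap.mem hlower.le]
  refine ⟨h.gap.le.trans_lt hlower, fun k hk hlt => not_lt.1 fun hkf => ?_⟩
  exact (h.gap.consecutive k hk hkf).not_gt (hlower.trans hlt)

theorem not_tight (hk : k ∈ K) (hkf : k < f) : ¬ Tight K i (crossingMap K i σ d f c) k :=
  h.sweepInv.not_tight_borrowSweep hk (h.gap.consecutive k hk hkf)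

theorem exists_lt_lower : ∃ k ∈ K, f < k ∧ crossingMap K i σ d f c k < d := by
  have hrotate := h.rotateInv.rotate h.gap
  obtain ⟨r, hr, hfr, hri, -⟩ := hrotate.exists_large
  have hlower := hrotate.lower_lt
  rw [h.rotateInv.rotate_snd h.gap] at hlower
  refine ⟨r, hr, hfr.lt_of_ne ?_, (h.sweepInv.agreeFrom_borrowSweep.lt_iff hr).2
    (hri.trans_le h.gap.le)⟩
  rintro rfl
  exact hri.not_ge (h.gap.le.trans hlower.le)

end IsCrossingAt

theorem IsClosedAt.borrowSweep_ne_crossingMap (hd : IsClosedAt K i σ d) (hσ : IsArcMap K L σ)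
    (h : IsCrossingAt K L i τ d' f c) : borrowSweep K i σ d ≠ crossingMap K i τ d' f c := by
  intro heq
  have hi := h.gap.left_notMem
  have hclosed := fun k hk => hd.le_of_borrowSweep_lt (k := k) hσ hi hk
  have hnot := fun k hk => (hd.sweepInv hσ hi).not_tight_borrowSweep (k := k) hk
  rw [heq] at hclosed hnot
  have hdf : d < f := not_le.1 fun hle => hnot f h.gap.mem hle h.tight
  have hdd' : d ≤ d' := h.gap.consecutive d hd.mem hdf
  have hd' : d' ∈ K := h.gap.eq_or_mem.resolve_left (hd.lt.trans_le hdd').ne'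
  have hd'd : d' ≤ d := le_of_closed_of_not_tight h.isArcMap hi hd.lt.le hclosed hd' fun k hk hle =>
    h.not_tight hk (hle.trans_lt h.gap.lt)
  obtain ⟨k, hk, hfk, hkd⟩ := h.exists_lt_lower
  exact (hclosed k hk (hkd.trans_le hd'd)).not_gt (hdf.trans hfk)

theorem IsClosedAt.eq_of_borrowSweep_eq (hd : IsClosedAt K i σ d) (hd' : IsClosedAt K i τ d')
    (hσ : IsArcMap K L σ) (hτ : IsArcMap K L τ) (hi : i ∉ L)
    (heq : borrowSweep K i σ d = borrowSweep K i τ d') : σ = τ := by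
  have hσd := hd.sweepInv hσ hi
  have hτd' := hd'.sweepInv hτ hi
  obtain rfl : d = d' := by
    apply le_antisymm
    · exact le_of_closed_of_not_tight hτd'.isArcMap_borrowSweep hi hd'.lt.le
        (fun k hk => hd'.le_of_borrowSweep_lt hτ hi hk) hd.mem
        fun k hk => heq ▸ hσd.not_tight_borrowSweep hk
    · exact le_of_closed_of_not_tight hσd.isArcMap_borrowSweep hi hd.lt.le
        (fun k hk => hd.le_of_borrowSweep_lt hσ hi hk) hd'.mem
        fun k hk => heq.symm ▸ hτd'.not_tight_borrowSweep hk
  exact hσd.eq_of_borrowSweep_eq hτd' heq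

theorem IsCrossingAt.upper_le (h : IsCrossingAt K L i σ d f c) (h' : IsCrossingAt K L i τ d' f' c')
    (heq : crossingMap K i σ d f c = crossingMap K i τ d' f' c') : f ≤ f' :=
  not_lt.1 fun hlt => h.not_tight h'.gap.mem hlt (heq.symm ▸ h'.tight)

theorem IsCrossingAt.last_le (h : IsCrossingAt K L i σ d f c) (h' : IsCrossingAt K L i τ d' f c')
    (heq : crossingMap K i σ d f c = crossingMap K i τ d' f c') : c ≤ c' := by
  have hc := h.rotateInv.mem
  refine h'.le_of_lt c hc ((h'.agreeFrom.lt_iff hc).1 (heq ▸ (h.agreeFrom.lt_iff hc).2 ?_))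
  exact h.rotateInv.lt_upper

theorem IsCrossingAt.eq_of_crossingMap_eq (h : IsCrossingAt K L i σ d f c)
    (h' : IsCrossingAt K L i τ d' f' c')
    (heq : crossingMap K i σ d f c = crossingMap K i τ d' f' c') : σ = τ := by
  obtain rfl : f = f' := (h.upper_le h' heq).antisymm (h'.upper_le h heq.symm)
  obtain rfl : d = d' := (h.gap.lower_le h'.gap).antisymm (h'.gap.lower_le h.gap)
  obtain rfl : c = c' := (h.last_le h' heq).antisymm (h'.last_le h heq.symm)
  have hrotate : rotate K i d f (σ, c) c = rotate K i d f (τ, c) c :=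
    Prod.ext (h.sweepInv.eq_of_borrowSweep_eq h'.sweepInv heq)
      ((h.rotateInv.rotate_snd h.gap).trans (h'.rotateInv.rotate_snd h.gap).symm)
  exact congrArg Prod.fst (h.rotateInv.eq_of_rotate_eq h.gap h'.rotateInv hrotate)

namespace Outcome

theorem isArcMap (h : Outcome K L i σ ω) (hσ : IsArcMap K L σ) (hi : i ∉ L) :
    IsArcMap K L ω := by
  obtain ⟨-, rfl⟩ | ⟨d, hd, rfl⟩ | ⟨d, f, c, hc, rfl⟩ := h
  · exact hσ
  · exact (hd.sweepInv hσ hi).isArcMap_borrowSweep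
  · exact hc.isArcMap

theorem eq_of_forall_le (h : Outcome K L i σ ω) (hσ : IsArcMap K L σ) (hi : i ∉ L)
    (hω : ∀ k ∈ K, i < k → i ≤ ω k) : ω = σ := by
  obtain ⟨-, rfl⟩ | ⟨d, hd, rfl⟩ | ⟨d, f, c, hc, rfl⟩ := h
  · rfl
  · obtain ⟨k, hk, hik, hki⟩ := (hd.sweepInv hσ hi).exists_borrowSweep_lt
    exact absurd hki (hω k hk hik).not_gt
  · obtain ⟨k, hk, hik, hki⟩ := hc.exists_lt
    exact absurd hki (hω k hk hik).not_gt

theorem left_unique (hσω : Outcome K L i σ ω) (hτω : Outcome K L i τ ω) (hσ : IsArcMap K L σ)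
    (hτ : IsArcMap K L τ) (hi : i ∉ L) : σ = τ := by
  by_cases hω : ∀ k ∈ K, i < k → i ≤ ω k
  · exact (hσω.eq_of_forall_le hσ hi hω).symm.trans (hτω.eq_of_forall_le hτ hi hω)
  obtain ⟨h, rfl⟩ | ⟨d, hd, rfl⟩ | ⟨d, f, c, hc, rfl⟩ := hσω
  · exact absurd h hω
  · obtain ⟨h, rfl⟩ | ⟨d', hd', heq⟩ | ⟨d', f', c', hc', heq⟩ := hτω
    · exact absurd h hω
    · exact hd.eq_of_borrowSweep_eq hd' hσ hτ hi heq
    · exact absurd heq (hd.borrowSweep_ne_crossingMap hσ hc')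
  · obtain ⟨h, rfl⟩ | ⟨d', hd', heq⟩ | ⟨d', f', c', hc', heq⟩ := hτω
    · exact absurd h hω
    · exact absurd heq.symm (hd'.borrowSweep_ne_crossingMap hτ hc)
    · exact hc.eq_of_crossingMap_eq hc' heq

end Outcome

end Outcomes

section Rearrangement

variable {V : Type*} [LinearOrder V] {K L : Finset V} {M M' : Finset (V × V)} {σ ρ : V → V}
  {d e f i k r t : V}

/-- Algorithms I and II, applied in turn to `N`. -/
def rearrange (N : Finset (V × V)) (i t : V) : Option (Finset (V × V)) := do
  let M₁ ← algorithmI N i t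
  algorithmII N i t M₁

/-- The critical large arc of the matching of `σ` ends at `r`. -/
structure IsCriticalLarge (K : Finset V) (i : V) (σ : V → V) (r : V) : Prop where
  mem : r ∈ K
  lt : i < r
  large : σ r < i
  le : ∀ k ∈ K, i < k → σ k < i → k ≤ r

/-- The critical large arc of the matching of `σ` ends at `r`, and the critical small arc
at `e`. -/
structure IsCriticalSmall (K : Finset V) (i : V) (σ : V → V) (r e : V) : Prop where
  large : IsCriticalLarge K i σ r
  mem : e ∈ K
  small : i < σ e
  apply_lt : σ e < r
  lt : r < e
  le : ∀ k ∈ K, i < σ k → σ k < r → r < k → σ e ≤ σ k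

theorem exists_isCriticalLarge (h : ∃ k ∈ K, i < k ∧ σ k < i) :
    ∃ r, IsCriticalLarge K i σ r := by
  obtain ⟨r, hr, hmax⟩ := Finset.exists_max_image (K.filter fun k => i < k ∧ σ k < i) id
    (Finset.filter_nonempty_iff.2 h)
  obtain ⟨hrK, hir, hri⟩ := Finset.mem_filter.1 hr
  exact ⟨r, hrK, hir, hri, fun k hk hik hki => hmax k (Finset.mem_filter.2 ⟨hk, hik, hki⟩)⟩

theorem IsCriticalLarge.exists_isCriticalSmall (hr : IsCriticalLarge K i σ r)
    (h : ∃ k ∈ K, i < σ k ∧ σ k < r ∧ r < k) : ∃ e, IsCriticalSmall K i σ r e := by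
  obtain ⟨e, he, hmin⟩ := Finset.exists_min_image
    (K.filter fun k => i < σ k ∧ σ k < r ∧ r < k) σ (Finset.filter_nonempty_iff.2 h)
  obtain ⟨heK, hie, her, hre⟩ := Finset.mem_filter.1 he
  exact ⟨e, hr, heK, hie, her, hre, fun k hk hik hkr hrk =>
    hmin k (Finset.mem_filter.2 ⟨hk, hik, hkr, hrk⟩)⟩

theorem crosses_iff {a b c : V} (ha : a < i) (hb : i < b) :
    Crosses (b, c) (a, r) ↔ b < r ∧ r < c := by
  simp only [Crosses]
  grind

theorem regionR_arcsOf (ht : ∀ k ∈ K, k < t) : regionR (arcsOf K σ) i t = after K i := by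
  rw [regionR, rights_arcsOf]
  exact Finset.filter_congr fun k hk => and_iff_left (ht k hk)

theorem criticalLarge_arcsOf_eq_none (ht : ∀ k ∈ K, k < t) (h : ∀ k ∈ K, i < k → i ≤ σ k) :
    criticalLarge (arcsOf K σ) i t = none := by
  rw [criticalLarge, regionR_arcsOf ht, rights_filter_arcsOf,
    Finset.filter_false_of_mem (by grind), maxOpt_empty]
  rfl

theorem IsCriticalLarge.criticalLarge_arcsOf (hr : IsCriticalLarge K i σ r)
    (ht : ∀ k ∈ K, k < t) : criticalLarge (arcsOf K σ) i t = some (σ r, r) := by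
  have hmax : maxOpt (K.filter fun k => σ k < i ∧ k ∈ after K i) = some r := by
    obtain ⟨hrK, hir, hri, hle⟩ := hr
    refine maxOpt_eq_some_iff.2 ⟨by simp [hrK, hir, hri], fun k hk => ?_⟩
    grind
  rw [criticalLarge, regionR_arcsOf ht, rights_filter_arcsOf, hmax]
  simp [leftOf_arcsOf hr.mem]

theorem IsCriticalLarge.criticalSmall_arcsOf_eq_none (hr : IsCriticalLarge K i σ r)
    (ht : ∀ k ∈ K, k < t) (h : ∀ k ∈ K, i < σ k → σ k < r → k ≤ r) :
    criticalSmall (arcsOf K σ) i t = none := by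
  have hempty : (K.filter fun k => i < σ k ∧ Crosses (σ k, k) (σ r, r)) = ∅ := by
    refine Finset.filter_false_of_mem fun k hk ⟨hik, hcross⟩ => ?_
    obtain ⟨hkr, hrk⟩ := (crosses_iff hr.large hik).1 hcross
    exact (h k hk hik hkr).not_gt hrk
  simp [criticalSmall, hr.criticalLarge_arcsOf ht, lefts_filter_arcsOf, hempty, minOpt_empty]

theorem IsCriticalSmall.criticalSmall_arcsOf (he : IsCriticalSmall K i σ r e)
    (h : IsArcMap K L σ) (ht : ∀ k ∈ K, k < t) :
    criticalSmall (arcsOf K σ) i t = some (σ e, e) := by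
  have hmin : minOpt ((K.filter fun k => i < σ k ∧ Crosses (σ k, k) (σ r, r)).image σ) =
      some (σ e) := by
    refine minOpt_eq_some_iff.2 ⟨Finset.mem_image_of_mem σ (Finset.mem_filter.2
      ⟨he.mem, he.small, (crosses_iff he.large.large he.small).2 ⟨he.apply_lt, he.lt⟩⟩), ?_⟩
    intro a ha
    obtain ⟨k, hk, rfl⟩ := Finset.mem_image.1 ha
    obtain ⟨hkK, hik, hcross⟩ := Finset.mem_filter.1 hk
    obtain ⟨hkr, hrk⟩ := (crosses_iff he.large.large hik).1 hcross
    exact he.le k hkK hik hkr hrk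
  simp [criticalSmall, he.large.criticalLarge_arcsOf ht, lefts_filter_arcsOf, hmin,
    h.rightOf_arcsOf he.mem]

theorem rearrange_arcsOf_of_forall_le (ht : ∀ k ∈ K, k < t) (h : ∀ k ∈ K, i < k → i ≤ σ k) :
    rearrange (arcsOf K σ) i t = some (arcsOf K σ) := by
  have hL := criticalLarge_arcsOf_eq_none ht h
  have hS : criticalSmall (arcsOf K σ) i t = none := by simp [criticalSmall, hL]
  simp [rearrange, algorithmI, algorithmII, hL, hS, regionR2, maxOpt_empty]

theorem IsCriticalLarge.rearrange_arcsOf (hr : IsCriticalLarge K i σ r) (h : IsArcMap K L σ)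
    (hi : i ∉ L) (ht : ∀ k ∈ K, k < t) (hclosed : IsClosedAt K i σ r) :
    rearrange (arcsOf K σ) i t = some (arcsOf K (borrowSweep K i σ r)) := by
  have hS := hr.criticalSmall_arcsOf_eq_none ht fun k hk _ => hclosed.closed k hk
  have hmax : maxOpt (regionR2 (arcsOf K σ) i t) = some r := by
    simp only [regionR2, hr.criticalLarge_arcsOf ht, hS, regionR_arcsOf ht]
    refine maxOpt_eq_some_iff.2 ⟨by simp [hr.mem, hr.lt], fun k hk => ?_⟩
    exact (Finset.mem_filter.1 hk).2
  obtain ⟨p, hp⟩ := (hclosed.sweepInv h hi).exists_foldlM_stepII hr.mem hr.large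
  simp [rearrange, algorithmI, algorithmII, hS, hmax, borrow, leftOf_arcsOf hr.mem, hr.large,
    regionR_arcsOf ht, hp]

theorem SweepInv.algorithmII_arcsOf (h : SweepInv K L i d σ f) (g : Gap K L i d f)
    (ht : ∀ k ∈ K, k < t) (hL : criticalLarge (arcsOf K ρ) i t = some (ρ r, r))
    (hS : criticalSmall (arcsOf K ρ) i t = some (ρ e, e)) (hde : d < ρ e) (hef : ρ e < f) :
    algorithmII (arcsOf K ρ) i t (arcsOf K σ) = some (arcsOf K (borrowSweep K i σ f)) := by
  have hR₂ : regionR2 (arcsOf K ρ) i t = (after K i).filter (· < ρ e) := by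
    simp only [regionR2, hL, hS, regionR_arcsOf ht]
  have hle : ∀ k ∈ after K i, k < f → k ≤ d := fun k hk =>
    g.consecutive k (Finset.mem_filter.1 hk).1
  obtain rfl | hid := g.le.eq_or_lt
  · have hle' : ∀ k ∈ after K i, f ≤ k := fun k hk => not_lt.1 fun hkf =>
      (hle k hk hkf).not_gt (Finset.mem_filter.1 hk).2
    have hmax : maxOpt (regionR2 (arcsOf K ρ) i t) = none := by
      rw [hR₂, Finset.filter_false_of_mem fun k hk => (hef.trans_le (hle' k hk)).not_gt,
        maxOpt_empty]
    rw [borrowSweep, sweepLeft_of_forall_le hle']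
    simp [algorithmII, hmax]
  · have hd : d ∈ after K i := by simp [g.eq_or_mem.resolve_left hid.ne', hid]
    have hlast : IsLastBefore (after K i) f d := ⟨hd, g.lt, hle⟩
    have hmax : maxOpt (regionR2 (arcsOf K ρ) i t) = some d := by
      rw [hR₂, maxOpt_eq_some_iff]
      refine ⟨Finset.mem_filter.2 ⟨hd, hde⟩, fun k hk => ?_⟩
      obtain ⟨hk, hke⟩ := Finset.mem_filter.1 hk
      exact hle k hk (lt_trans hke hef)
    have hdK := (Finset.mem_filter.1 hd).1
    have hlarge := fun _ : ¬ σ d < i => h.exists_large_after g.lt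
    obtain ⟨p, hp⟩ := (h.borrowMap hlast).exists_foldlM_stepII hdK (borrowMap_self_lt hlarge)
    rw [borrowSweep, hlast.sweepLeft_eq, ← borrowSweep]
    simp [algorithmII, hmax, borrow_arcsOf h.arcMap hdK hlarge, regionR_arcsOf ht, hp]

theorem IsCriticalSmall.exists_gap (he : IsCriticalSmall K i σ r e) (h : IsArcMap K L σ)
    (hi : i ∉ L) : ∃ d f, Gap K L i d f ∧ d < σ e ∧ σ e < f ∧ f ≤ r ∧
      ∀ k ∈ K, σ e < k → f ≤ k := by
  obtain ⟨f, hf, hfmin⟩ := Finset.exists_min_image (K.filter (σ e < ·)) id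
    ⟨r, Finset.mem_filter.2 ⟨he.large.mem, he.apply_lt⟩⟩
  obtain ⟨hfK, hef⟩ := Finset.mem_filter.1 hf
  obtain ⟨d, hd, hdmax⟩ := Finset.exists_max_image
    (insert i (K.filter fun k => i < k ∧ k < σ e)) id (Finset.insert_nonempty _ _)
  have hfmin' : ∀ k ∈ K, σ e < k → f ≤ k := fun k hk hek =>
    hfmin k (Finset.mem_filter.2 ⟨hk, hek⟩)
  have hid : i ≤ d := hdmax i (Finset.mem_insert_self _ _)
  have hd' : d = i ∨ d ∈ K ∧ d < σ e := by
    simp only [Finset.mem_insert, Finset.mem_filter] at hd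
    grind
  have hde : d < σ e := hd'.elim (fun hdi => hdi ▸ he.small) And.right
  refine ⟨d, f, ⟨hid, hde.trans hef, hfK, hd'.imp_right And.left, fun k hk hkf => ?_, hi, ?_,
    h.notMem_left hfK⟩, hde, hef, hfmin' r he.large.mem he.apply_lt, hfmin'⟩
  · by_contra! hdk
    have hke : k < σ e := (not_lt.1 fun hek => (hfmin' k hk hek).not_gt hkf).lt_of_ne
      fun heq => h.notMem_right he.mem (heq ▸ hk)
    exact (hdmax k (by simp [hk, hid.trans_lt hdk, hke])).not_gt hdk
  · exact hd'.elim (fun hdi => hdi ▸ hi) fun hd' => h.notMem_left hd'.1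

theorem IsCriticalSmall.apply_le_apply (he : IsCriticalSmall K i σ r e) (h : IsArcMap K L σ)
    (hi : i ∉ L) (hk : k ∈ K) (hrk : r < k) : σ e ≤ σ k := by
  by_contra! hke
  have hik : i ≤ σ k := not_lt.1 fun hki =>
    (he.large.le k hk (he.large.lt.trans hrk) hki).not_gt hrk
  exact (he.le k hk (hik.lt_of_ne (h.ne hi hk).symm) (hke.trans he.apply_lt) hrk).not_gt hke

theorem IsCriticalSmall.rotateInv {c : V} (he : IsCriticalSmall K i σ r e) (h : IsArcMap K L σ)
    (g : Gap K L i d f) (hde : d < σ e) (hfr : f ≤ r) (hc : c ∈ K) (hrc : r < c)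
    (hcf : σ c < f) : RotateInv K L i d f (σ, c) c where
  arcMap := h
  mem := hc
  le := le_rfl
  upper_le := hfr.trans hrc.le
  lower_lt := hde.trans_le (he.apply_le_apply h g.left_notMem hc hrc)
  lt_upper := hcf
  between _ _ hck hkc := absurd hck hkc.not_ge
  largeFirst k hk hkd := by
    obtain ⟨hkK, hck⟩ := Finset.mem_filter.1 hk
    have := he.apply_le_apply h g.left_notMem hkK (hrc.trans hck)
    exact absurd hkd (hde.trans_le this).not_gt
  exists_large := ⟨r, he.large.mem, hfr, he.large.large, fun k hk _ hkd => not_lt.1 fun hrk =>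
    (hde.trans_le (he.apply_le_apply h g.left_notMem hk hrk)).not_gt hkd⟩

theorem IsCriticalSmall.algorithmI_arcsOf (he : IsCriticalSmall K i σ r e) (h : IsArcMap K L σ)
    (g : Gap K L i d f) (ht : ∀ k ∈ K, k < t) (hde : d < σ e) (hef : σ e < f) (hfr : f ≤ r)
    (hf : ∀ k ∈ K, σ e < k → f ≤ k) :
    algorithmI (arcsOf K σ) i t = some (arcsOf K (rotate K i d f (σ, e) e).1) := by
  have hS := he.criticalSmall_arcsOf h ht
  have hlist : leftwards (regionR1 (arcsOf K σ) i t) e = leftwards (K.filter (f ≤ ·)) e := by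
    refine leftwards_congr fun k hke => ?_
    have := he.small
    simp only [regionR1, hS, regionR_arcsOf ht, Finset.mem_filter]
    grind
  have hfold := (he.rotateInv h g hde hfr he.mem he.lt hef).foldlM_stepI g
  simp [algorithmI, hS, hlist, hfold]

theorem IsCriticalSmall.exists_rearrange (he : IsCriticalSmall K i σ r e) (h : IsArcMap K L σ)
    (hi : i ∉ L) (ht : ∀ k ∈ K, k < t) :
    ∃ ω, rearrange (arcsOf K σ) i t = some (arcsOf K ω) ∧ Outcome K L i σ ω := by
  obtain ⟨d, f, g, hde, hef, hfr, hf⟩ := he.exists_gap h hi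
  obtain ⟨c, hc, hcmax⟩ := Finset.exists_max_image (K.filter (σ · < f)) id
    ⟨e, Finset.mem_filter.2 ⟨he.mem, hef⟩⟩
  obtain ⟨hcK, hcf⟩ := Finset.mem_filter.1 hc
  have hec : e ≤ c := hcmax e (Finset.mem_filter.2 ⟨he.mem, hef⟩)
  have hcross : IsCrossingAt K L i σ d f c :=
    ⟨g, fun k hk hkf => hcmax k (Finset.mem_filter.2 ⟨hk, hkf⟩),
      he.rotateInv h g hde hfr hcK (he.lt.trans_le hec) hcf⟩
  have hrotate : rotate K i d f (σ, c) c = rotate K i d f (σ, e) e := by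
    obtain rfl | hlt := hec.eq_or_lt
    · rfl
    · exact rotate_eq_of_forall_lt he.mem (hfr.trans he.lt.le) hlt hde hef fun k hk hek =>
        hde.trans_le (he.apply_le_apply h hi hk (he.lt.trans_le hek))
  refine ⟨crossingMap K i σ d f c, ?_, .crossing d f c hcross rfl⟩
  rw [rearrange, he.algorithmI_arcsOf h g ht hde hef hfr hf, ← hrotate]
  exact hcross.sweepInv.algorithmII_arcsOf g ht (he.large.criticalLarge_arcsOf ht)
    (he.criticalSmall_arcsOf h ht) hde hef

theorem IsArcMap.exists_rearrange (h : IsArcMap K L σ) (hi : i ∉ L) (ht : ∀ k ∈ K, k < t) :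
    ∃ ω, rearrange (arcsOf K σ) i t = some (arcsOf K ω) ∧ Outcome K L i σ ω := by
  by_cases hlarge : ∃ k ∈ K, i < k ∧ σ k < i
  · obtain ⟨r, hr⟩ := exists_isCriticalLarge hlarge
    by_cases hsmall : ∃ k ∈ K, i < σ k ∧ σ k < r ∧ r < k
    · obtain ⟨e, he⟩ := hr.exists_isCriticalSmall hsmall
      exact he.exists_rearrange h hi ht
    · have hclosed : IsClosedAt K i σ r := by
        refine ⟨hr.mem, hr.lt, hr.large, fun k hk hkr => ?_⟩
        have := h.ne hi hk
        have := hr.lt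
        have := hr.le k hk
        grind
      exact ⟨_, hr.rearrange_arcsOf h hi ht hclosed, .closed r hclosed rfl⟩
  · push Not at hlarge
    exact ⟨σ, rearrange_arcsOf_of_forall_le ht hlarge, .noLarge hlarge rfl⟩

theorem IsMatching.exists_rearrange (h : IsMatching K L M) (hi : i ∉ L) (ht : ∀ k ∈ K, k < t) :
    ∃ M', rearrange M i t = some M' ∧ IsMatching K L M' := by
  obtain ⟨σ, hσ, rfl⟩ := h.exists_isArcMap
  obtain ⟨ω, hω, hout⟩ := hσ.exists_rearrange hi ht
  exact ⟨arcsOf K ω, hω, (hout.isArcMap hσ hi).isMatching_arcsOf⟩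

theorem IsMatching.eq_of_rearrange_eq (h : IsMatching K L M) (h' : IsMatching K L M')
    (hi : i ∉ L) (ht : ∀ k ∈ K, k < t) (heq : rearrange M i t = rearrange M' i t) : M = M' := by
  obtain ⟨σ, hσ, rfl⟩ := h.exists_isArcMap
  obtain ⟨τ, hτ, rfl⟩ := h'.exists_isArcMap
  obtain ⟨ω, hω, hout⟩ := hσ.exists_rearrange hi ht
  obtain ⟨ω', hω', hout'⟩ := hτ.exists_rearrange hi ht
  have harcs : arcsOf K ω = arcsOf K ω' := Option.some_inj.1 (hω ▸ hω' ▸ heq)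
  obtain rfl : ω = ω' := (hout.isArcMap hσ hi).arcsOf_injective (hout'.isArcMap hτ hi) harcs
  rw [hout.left_unique hout' hσ hτ hi]

end Rearrangement

section Recursion

variable {V : Type*} [LinearOrder V] {K L : Finset V} {M M' N : Finset (V × V)} {i t : V}
  {m : ℕ}

namespace IsMatching

theorem card_eq (h : IsMatching K L M) : M.card = K.card := by
  rw [← h.rights_eq, rights, Finset.card_image_of_injOn h.snd_injOn]

theorem fst_mem (h : IsMatching K L M) {e : V × V} (he : e ∈ M) : e.1 ∈ L :=
  h.lefts_eq ▸ Finset.mem_image_of_mem Prod.fst he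

theorem snd_mem (h : IsMatching K L M) {e : V × V} (he : e ∈ M) : e.2 ∈ K :=
  h.rights_eq ▸ Finset.mem_image_of_mem Prod.snd he

theorem exists_mem (h : IsMatching K L M) (ht : t ∈ K) : ∃ i, (i, t) ∈ M := by
  rw [← h.rights_eq, rights, Finset.mem_image] at ht
  obtain ⟨e, he, rfl⟩ := ht
  exact ⟨e.1, he⟩

theorem erase (h : IsMatching K L M) {e : V × V} (he : e ∈ M) :
    IsMatching (K.erase e.2) (L.erase e.1) (M.erase e) where
  rights_eq := by
    rw [← h.rights_eq, rights, rights, ← Finset.coe_inj]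
    push_cast
    exact (h.snd_injOn.image_sdiff_subset (by simpa)).trans (by simp)
  lefts_eq := by
    rw [← h.lefts_eq, lefts, lefts, ← Finset.coe_inj]
    push_cast
    exact (h.fst_injOn.image_sdiff_subset (by simpa)).trans (by simp)
  disjoint := h.disjoint.mono (Finset.erase_subset _ _) (Finset.erase_subset _ _)
  lt e' he' := h.lt e' (Finset.mem_of_mem_erase he')
  fst_injOn := h.fst_injOn.mono (by simp)
  snd_injOn := h.snd_injOn.mono (by simp)

theorem insert_of_erase (h : IsMatching (K.erase t) (L.erase i) N) (hdisj : Disjoint K L)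
    (ht : t ∈ K) (hi : i ∈ L) (hit : i < t) : IsMatching K L (insert (i, t) N) where
  rights_eq := by rw [rights, Finset.image_insert, ← rights, h.rights_eq, Finset.insert_erase ht]
  lefts_eq := by rw [lefts, Finset.image_insert, ← lefts, h.lefts_eq, Finset.insert_erase hi]
  disjoint := hdisj
  lt e he := by
    obtain rfl | he := Finset.mem_insert.1 he
    · exact hit
    · exact h.lt e he
  fst_injOn := by
    rw [Finset.coe_insert, Set.injOn_insert fun he => Finset.notMem_erase i L (h.fst_mem he)]
    refine ⟨h.fst_injOn, ?_⟩
    rintro ⟨e, he, heq⟩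
    exact Finset.ne_of_mem_erase (h.fst_mem he) heq
  snd_injOn := by
    rw [Finset.coe_insert, Set.injOn_insert fun he => Finset.notMem_erase t K (h.snd_mem he)]
    refine ⟨h.snd_injOn, ?_⟩
    rintro ⟨e, he, heq⟩
    exact Finset.ne_of_mem_erase (h.snd_mem he) heq

theorem phiAux_succ (h : IsMatching K L M) (he : (i, t) ∈ M) (ht : ∀ k ∈ K, k ≤ t) :
    phiAux (m + 1) M = ((phiAux m (M.erase (i, t))).bind (rearrange · i t)).map
      (insert (i, t)) := by
  have hmax : maxOpt (rights M) = some t := by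
    rw [maxOpt_eq_some_iff, h.rights_eq]
    exact ⟨h.snd_mem he, ht⟩
  simp only [phiAux, hmax, leftOf_eq_some h.snd_injOn he, rearrange, Option.bind_eq_bind,
    Option.bind_some, Option.map_eq_bind, Option.bind_assoc, Function.comp_def]

theorem exists_phiAux_succ (h : IsMatching K L M) (he : (i, t) ∈ M) (ht : ∀ k ∈ K, k ≤ t)
    (hN : IsMatching (K.erase t) (L.erase i) N) (hphi : phiAux m (M.erase (i, t)) = some N) :
    ∃ N', rearrange N i t = some N' ∧ IsMatching (K.erase t) (L.erase i) N' ∧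
      IsMatching K L (insert (i, t) N') ∧ phiAux (m + 1) M = some (insert (i, t) N') := by
  obtain ⟨N', hN', hmatch⟩ := hN.exists_rearrange (t := t) (Finset.notMem_erase i L) fun k hk =>
    (ht k (Finset.mem_of_mem_erase hk)).lt_of_ne (Finset.ne_of_mem_erase hk)
  refine ⟨N', hN', hmatch, hmatch.insert_of_erase h.disjoint (h.snd_mem he) (h.fst_mem he)
    (h.lt _ he), ?_⟩
  rw [h.phiAux_succ he ht, hphi, Option.bind_some, hN', Option.map_some]

theorem exists_phiAux (h : IsMatching K L M) (hm : K.card = m) :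
    ∃ M', phiAux m M = some M' ∧ IsMatching K L M' := by
  induction m generalizing K L M with
  | zero => exact ⟨M, rfl, h⟩
  | succ m ih =>
    obtain ⟨t, htK, ht⟩ := Finset.exists_max_image K id (Finset.card_pos.1 (by omega))
    obtain ⟨i, he⟩ := h.exists_mem htK
    obtain ⟨N, hphi, hN⟩ := ih (h.erase he) (by rw [Finset.card_erase_of_mem htK, hm]; rfl)
    obtain ⟨N', -, -, hmatch, hphi'⟩ := h.exists_phiAux_succ he ht hN hphi
    exact ⟨_, hphi', hmatch⟩

theorem eq_of_phiAux_eq (h : IsMatching K L M) (h' : IsMatching K L M') (hm : K.card = m)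
    (heq : phiAux m M = phiAux m M') : M = M' := by
  induction m generalizing K L M M' with
  | zero => exact Option.some_inj.1 heq
  | succ m ih =>
    obtain ⟨t, htK, ht⟩ := Finset.exists_max_image K id (Finset.card_pos.1 (by omega))
    have hcard : (K.erase t).card = m := by rw [Finset.card_erase_of_mem htK, hm]; rfl
    obtain ⟨i, he⟩ := h.exists_mem htK
    obtain ⟨i', he'⟩ := h'.exists_mem htK
    obtain ⟨N, hphi, hN⟩ := (h.erase he).exists_phiAux hcard
    obtain ⟨N', hphi', hN'⟩ := (h'.erase he').exists_phiAux hcard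
    obtain ⟨N₁, hN₁, hmatch, hins, hM⟩ := h.exists_phiAux_succ he ht hN hphi
    obtain ⟨N₁', hN₁', hmatch', -, hM'⟩ := h'.exists_phiAux_succ he' ht hN' hphi'
    have hinsert : insert (i, t) N₁ = insert (i', t) N₁' := Option.some_inj.1 (hM ▸ hM' ▸ heq)
    have hmem : (i', t) ∈ insert (i, t) N₁ := hinsert ▸ Finset.mem_insert_self _ _
    obtain rfl : i = i' := congrArg Prod.fst
      (hins.snd_injOn (Finset.mem_coe.2 (Finset.mem_insert_self (i, t) N₁)) hmem rfl)
    obtain rfl : N₁ = N₁' := by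
      have hnotMem : ∀ {N}, IsMatching (K.erase t) (L.erase i) N → (i, t) ∉ N := fun hN hmem =>
        Finset.notMem_erase t K (hN.snd_mem hmem)
      rw [← Finset.erase_insert (hnotMem hmatch), hinsert, Finset.erase_insert (hnotMem hmatch')]
    obtain rfl : N = N' := hN.eq_of_rearrange_eq hN' (Finset.notMem_erase i L)
      (fun k hk => (ht k (Finset.mem_of_mem_erase hk)).lt_of_ne (Finset.ne_of_mem_erase hk))
      (hN₁.trans hN₁'.symm)
    have herase := ih (h.erase he) (h'.erase he') hcard (hphi.trans hphi'.symm)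
    rw [← Finset.insert_erase he, herase, Finset.insert_erase he']

theorem exists_phiMatching (h : IsMatching K L M) :
    ∃ M', phiMatching M = some M' ∧ IsMatching K L M' := by
  rw [phiMatching, h.card_eq]
  exact h.exists_phiAux rfl

theorem eq_of_phiMatching_eq (h : IsMatching K L M) (h' : IsMatching K L M')
    (heq : phiMatching M = phiMatching M') : M = M' := by
  rw [phiMatching, phiMatching, h.card_eq, h'.card_eq] at heq
  exact h.eq_of_phiAux_eq h' rfl heq

end IsMatching

end Recursion

section IncreasingPaths

open Relation

variable {α : Type*} {r : α → α → Prop} {x y : α}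

theorem reflTransGen_or_of_eqvGen (hleft : Relator.LeftUnique r) (hright : Relator.RightUnique r)
    (h : EqvGen r x y) : ReflTransGen r x y ∨ ReflTransGen r y x := by
  induction h with
  | rel x y h => exact .inl (.single h)
  | refl x => exact .inl .refl
  | symm x y _ ih => exact ih.symm
  | trans x y z _ _ ihxy ihyz =>
    rcases ihxy, ihyz with ⟨hxy | hyx, hyz | hzy⟩
    · exact .inl (hxy.trans hyz)
    · rw [← reflTransGen_swap] at hxy hzy
      exact (ReflTransGen.total_of_right_unique hleft.flip hxy hzy).symm.imp
        reflTransGen_swap.1 reflTransGen_swap.1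
    · exact ReflTransGen.total_of_right_unique hright hyx hyz
    · exact .inr (hzy.trans hyx)

variable [LinearOrder α]

theorem le_of_reflTransGen (hlt : ∀ a b, r a b → a < b) (h : ReflTransGen r x y) : x ≤ y := by
  induction h with
  | refl => exact le_rfl
  | tail _ hbc ih => exact ih.trans (hlt _ _ hbc).le

theorem exists_rel_le_of_eqvGen (hlt : ∀ a b, r a b → a < b) (hleft : Relator.LeftUnique r)
    (hright : Relator.RightUnique r) (h : EqvGen r x y) (hxy : x < y) :
    ∃ z, r x z ∧ EqvGen r x z ∧ z ≤ y := by
  obtain hpath | hpath := reflTransGen_or_of_eqvGen hleft hright h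
  · obtain rfl | ⟨z, hxz, hzy⟩ := hpath.cases_head
    · exact absurd hxy (lt_irrefl x)
    · exact ⟨z, hxz, .rel _ _ hxz, le_of_reflTransGen hlt hzy⟩
  · exact absurd hxy (le_of_reflTransGen hlt hpath).not_gt

theorem consecutive_eqvGen_iff (hlt : ∀ a b, r a b → a < b) (hleft : Relator.LeftUnique r)
    (hright : Relator.RightUnique r) :
    (EqvGen r x y ∧ x < y ∧ ∀ z, EqvGen r x z → ¬(x < z ∧ z < y)) ↔ r x y := by
  constructor
  · rintro ⟨h, hxy, hbetween⟩
    obtain ⟨z, hxz, hgen, hzy⟩ := exists_rel_le_of_eqvGen hlt hleft hright h hxy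
    obtain rfl | hzy := hzy.eq_or_lt
    · exact hxz
    · exact absurd ⟨hlt _ _ hxz, hzy⟩ (hbetween z hgen)
  · refine fun hxy => ⟨.rel _ _ hxy, hlt _ _ hxy, fun z hz ⟨hxz, hzy⟩ => ?_⟩
    obtain ⟨w, hxw, -, hwz⟩ := exists_rel_le_of_eqvGen hlt hleft hright hz hxz
    exact hzy.not_ge (hright hxw hxy ▸ hwz)

end IncreasingPaths

section Blocks

variable {n : ℕ} {P : SetPartition n} {a b x y : Fin n}

theorem mem_part_iff : y ∈ P.part x ↔ P.part x = P.part y := by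
  rw [P.mem_part_iff_part_eq_part (by simp) (by simp), eq_comm]

theorem exists_part_iff {p : Finset (Fin n) → Prop} :
    (∃ B ∈ P.parts, x ∈ B ∧ p B) ↔ p (P.part x) := by
  constructor
  · rintro ⟨B, hB, hx, h⟩
    rwa [P.part_eq_of_mem hB hx]
  · exact fun h => ⟨P.part x, P.part_mem.2 (by simp), P.mem_part (by simp), h⟩

theorem mem_minElems : x ∈ minElems P ↔ ∀ y, P.part x = P.part y → x ≤ y := by
  simp only [minElems, Finset.mem_filter_univ, exists_part_iff (p := fun B => ∀ y ∈ B, x ≤ y),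
    mem_part_iff]

theorem mem_maxElems : x ∈ maxElems P ↔ ∀ y, P.part x = P.part y → y ≤ x := by
  simp only [maxElems, Finset.mem_filter_univ, exists_part_iff (p := fun B => ∀ y ∈ B, y ≤ x),
    mem_part_iff]

theorem mem_arcs : (a, b) ∈ arcs P ↔
    P.part a = P.part b ∧ a < b ∧ ∀ x, P.part a = P.part x → ¬ (a < x ∧ x < b) := by
  simp only [arcs, Finset.mem_filter_univ,
    exists_part_iff (p := fun B => b ∈ B ∧ a < b ∧ ∀ x ∈ B, ¬ (a < x ∧ x < b)), mem_part_iff]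

theorem exists_arc_ending (h : P.part x = P.part y) (hxy : x < y) :
    ∃ a, x ≤ a ∧ (a, y) ∈ arcs P := by
  obtain ⟨a, ha, hmax⟩ := Finset.exists_max_image
    {z | P.part z = P.part y ∧ z < y} id ⟨x, by simp [h, hxy]⟩
  simp only [id, Finset.mem_filter_univ] at ha hmax
  refine ⟨a, hmax x ⟨h, hxy⟩, mem_arcs.2 ⟨ha.1, ha.2, fun z hz ⟨haz, hzy⟩ => ?_⟩⟩
  exact (hmax z ⟨hz.symm.trans ha.1, hzy⟩).not_gt haz

theorem exists_arc_starting (h : P.part x = P.part y) (hxy : x < y) : ∃ b, (x, b) ∈ arcs P := by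
  obtain ⟨b, hb, hmin⟩ := Finset.exists_min_image
    {z | P.part x = P.part z ∧ x < z} id ⟨y, by simp [h, hxy]⟩
  simp only [id, Finset.mem_filter_univ] at hb hmin
  exact ⟨b, mem_arcs.2 ⟨hb.1, hb.2, fun z hz ⟨hxz, hzb⟩ => (hmin z ⟨hz, hxz⟩).not_gt hzb⟩⟩

theorem rights_arcs (P : SetPartition n) : rights (arcs P) = (minElems P)ᶜ := by
  ext b
  simp only [rights, Finset.mem_image, Finset.mem_compl, mem_minElems, Prod.exists,
    exists_eq_right, not_forall, not_le]
  constructor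
  · rintro ⟨a, h⟩
    obtain ⟨hpart, hab, -⟩ := mem_arcs.1 h
    exact ⟨a, hpart.symm, hab⟩
  · rintro ⟨x, hx, hxb⟩
    obtain ⟨a, -, ha⟩ := exists_arc_ending hx.symm hxb
    exact ⟨a, ha⟩

theorem lefts_arcs (P : SetPartition n) : lefts (arcs P) = (maxElems P)ᶜ := by
  ext a
  simp only [lefts, Finset.mem_image, Finset.mem_compl, mem_maxElems, Prod.exists,
    exists_and_right, exists_eq_right, not_forall, not_le]
  constructor
  · rintro ⟨b, h⟩
    obtain ⟨hpart, hab, -⟩ := mem_arcs.1 h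
    exact ⟨b, hpart, hab⟩
  · rintro ⟨y, hy, hay⟩
    exact exists_arc_starting hy hay

theorem rightUnique_arcs : Relator.RightUnique fun a b => (a, b) ∈ arcs P := by
  intro a b b' h h'
  obtain ⟨hpart, hab, hbetween⟩ := mem_arcs.1 h
  obtain ⟨hpart', hab', hbetween'⟩ := mem_arcs.1 h'
  exact (not_lt.1 fun hlt => hbetween b' hpart' ⟨hab', hlt⟩).antisymm
    (not_lt.1 fun hlt => hbetween' b hpart ⟨hab, hlt⟩)

theorem leftUnique_arcs : Relator.LeftUnique fun a b => (a, b) ∈ arcs P := by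
  intro a a' b h h'
  obtain ⟨hpart, hab, hbetween⟩ := mem_arcs.1 h
  obtain ⟨hpart', hab', hbetween'⟩ := mem_arcs.1 h'
  have hpart_eq := hpart.trans hpart'.symm
  exact (not_lt.1 fun hlt => hbetween' a hpart_eq.symm ⟨hlt, hab⟩).antisymm
    (not_lt.1 fun hlt => hbetween a' hpart_eq ⟨hlt, hab'⟩)

theorem part_eq_part_iff_eqvGen :
    P.part x = P.part y ↔ Relation.EqvGen (fun a b => (a, b) ∈ arcs P) x y := by
  constructor
  · intro h
    wlog hxy : x ≤ y generalizing x y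
    · exact .symm _ _ (this h.symm (le_of_not_ge hxy))
    induction y using WellFoundedLT.induction with
    | _ y ih =>
      obtain rfl | hlt := hxy.eq_or_lt
      · exact .refl _
      · obtain ⟨a, hxa, ha⟩ := exists_arc_ending h hlt
        obtain ⟨hpart, hay, -⟩ := mem_arcs.1 ha
        exact .trans _ _ _ (ih a hay (h.trans hpart.symm) hxa) (.rel _ _ ha)
  · intro h
    induction h with
    | rel x y h => exact (mem_arcs.1 h).1
    | refl x => rfl
    | symm x y _ ih => exact ih.symm
    | trans x y z _ _ ih ih' => exact ih.trans ih'

theorem arcs_injective : Function.Injective (arcs (n := n)) := by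
  intro P Q h
  have hpart (x) : P.part x = Q.part x := by
    ext y
    rw [mem_part_iff, mem_part_iff, part_eq_part_iff_eqvGen, part_eq_part_iff_eqvGen, h]
  ext B
  have hiff (R : SetPartition n) : B ∈ R.parts ↔ ∃ x, R.part x = B := by
    refine ⟨fun hB => ?_, ?_⟩
    · obtain ⟨x, hx⟩ := R.nonempty_of_mem_parts hB
      exact ⟨x, R.part_eq_of_mem hB hx⟩
    · rintro ⟨x, rfl⟩
      exact R.part_mem.2 (Finset.mem_univ x)
  simp only [hiff, hpart]

end Blocks

section SplitVertices

variable {n : ℕ} {P : SetPartition n} {S T : Finset (Fin n)} {a b : Fin n}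
  {M : Finset (SplitVertex n × SplitVertex n)}

/-- The vertices `i⁰` with `i ∉ S`: the right-hand endpoints of the matchings `M(P)` of the
partitions `P` whose set of minimal block elements is `S`. -/
def rightVertices (S : Finset (Fin n)) : Finset (SplitVertex n) := Sᶜ.image fun x => toLex (x, 0)

/-- The vertices `i¹` with `i ∉ T`: the left-hand endpoints of the matchings `M(P)` of the
partitions `P` whose set of maximal block elements is `T`. -/
def leftVertices (T : Finset (Fin n)) : Finset (SplitVertex n) := Tᶜ.image fun x => toLex (x, 1)

theorem toLex_mk_right_injective (u : Fin 2) :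
    Function.Injective fun x : Fin n => (toLex (x, u) : SplitVertex n) :=
  toLex.injective.comp (Prod.mk_left_injective u)

theorem rightVertices_injective : Function.Injective (rightVertices (n := n)) :=
  (Finset.image_injective (toLex_mk_right_injective 0)).comp compl_injective

theorem leftVertices_injective : Function.Injective (leftVertices (n := n)) :=
  (Finset.image_injective (toLex_mk_right_injective 1)).comp compl_injective

theorem disjoint_rightVertices_leftVertices (S T : Finset (Fin n)) :
    Disjoint (rightVertices S) (leftVertices T) := by
  simp [rightVertices, leftVertices, Finset.disjoint_left]

theorem toLex_one_lt_toLex_zero : (toLex (a, 1) : SplitVertex n) < toLex (b, 0) ↔ a < b := by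
  simp [Prod.Lex.toLex_lt_toLex]

theorem mem_toMatching : (toLex (a, 1), toLex (b, 0)) ∈ toMatching P ↔ (a, b) ∈ arcs P :=
  ((toLex_mk_right_injective 1).prodMap (toLex_mk_right_injective 0)).mem_finset_image (a := (a, b))

theorem toMatching_injective : Function.Injective (toMatching (n := n)) :=
  (Finset.image_injective ((toLex_mk_right_injective 1).prodMap
    (toLex_mk_right_injective 0))).comp arcs_injective

theorem isMatching_toMatching (P : SetPartition n) :
    IsMatching (rightVertices (minElems P)) (leftVertices (maxElems P)) (toMatching P) where
  rights_eq := by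
    simp only [rightVertices, ← rights_arcs, rights, toMatching, Finset.image_image]; rfl
  lefts_eq := by
    simp only [leftVertices, ← lefts_arcs, lefts, toMatching, Finset.image_image]; rfl
  disjoint := disjoint_rightVertices_leftVertices _ _
  lt := by
    simp only [toMatching, Finset.forall_mem_image, Prod.forall]
    exact fun a b h => toLex_one_lt_toLex_zero.2 (mem_arcs.1 h).2.1
  fst_injOn := by
    rw [toMatching, Finset.coe_image]
    rintro _ ⟨⟨a, b⟩, h, rfl⟩ _ ⟨⟨a', b'⟩, h', rfl⟩ heq
    obtain rfl : a = a' := toLex_mk_right_injective 1 heq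
    obtain rfl := rightUnique_arcs h h'
    rfl
  snd_injOn := by
    rw [toMatching, Finset.coe_image]
    rintro _ ⟨⟨a, b⟩, h, rfl⟩ _ ⟨⟨a', b'⟩, h', rfl⟩ heq
    obtain rfl : b = b' := toLex_mk_right_injective 0 heq
    obtain rfl := leftUnique_arcs h h'
    rfl

namespace IsMatching

variable (h : IsMatching (rightVertices S) (leftVertices T) M)

include h

theorem exists_eq_toLex {e : SplitVertex n × SplitVertex n} (he : e ∈ M) :
    ∃ a b, e = (toLex (a, 1), toLex (b, 0)) := by
  obtain ⟨a, -, ha⟩ := Finset.mem_image.1 (h.fst_mem he)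
  obtain ⟨b, -, hb⟩ := Finset.mem_image.1 (h.snd_mem he)
  exact ⟨a, b, Prod.ext ha.symm hb.symm⟩

theorem part_ofMatching_eq_iff {x y : Fin n} :
    (ofMatching M).part x = (ofMatching M).part y ↔
      Relation.EqvGen (fun a b => (toLex (a, 1), toLex (b, 0)) ∈ M) x y := by
  classical
  have hedge (a b : Fin n) : (∃ e ∈ M, (ofLex e.1).1 = a ∧ (ofLex e.2).1 = b) ↔
      (toLex (a, 1), toLex (b, 0)) ∈ M := by
    refine ⟨?_, fun he => ⟨_, he, rfl, rfl⟩⟩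
    rintro ⟨e, he, rfl, rfl⟩
    obtain ⟨a, b, rfl⟩ := h.exists_eq_toLex he
    exact he
  rw [← mem_part_iff, ofMatching, Finpartition.mem_part_ofSetoid_iff_rel]
  change Relation.EqvGen _ x y ↔ _
  simp only [hedge]

theorem mem_arcs_ofMatching :
    (a, b) ∈ arcs (ofMatching M) ↔ (toLex (a, 1), toLex (b, 0)) ∈ M := by
  simp only [mem_arcs, h.part_ofMatching_eq_iff]
  refine consecutive_eqvGen_iff (fun a b he => toLex_one_lt_toLex_zero.1 (h.lt _ he)) ?_ ?_
  · intro a a' b he he'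
    exact toLex_mk_right_injective 1 (congrArg Prod.fst (h.snd_injOn he he' rfl))
  · intro a b b' he he'
    exact toLex_mk_right_injective 0 (congrArg Prod.snd (h.fst_injOn he he' rfl))

theorem toMatching_ofMatching : toMatching (ofMatching M) = M := by
  ext e
  constructor
  · intro he
    obtain ⟨a, b, rfl⟩ := (isMatching_toMatching _).exists_eq_toLex he
    exact h.mem_arcs_ofMatching.1 (mem_toMatching.1 he)
  · intro he
    obtain ⟨a, b, rfl⟩ := h.exists_eq_toLex he
    exact mem_toMatching.2 (h.mem_arcs_ofMatching.2 he)

theorem ofMatching_mem_partitionsST : ofMatching M ∈ partitionsST S T := by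
  have hmatch := isMatching_toMatching (ofMatching M)
  rw [h.toMatching_ofMatching] at hmatch
  exact ⟨rightVertices_injective (hmatch.rights_eq.symm.trans h.rights_eq),
    leftVertices_injective (hmatch.lefts_eq.symm.trans h.lefts_eq)⟩

end IsMatching

end SplitVertices

end ArcDiagram

theorem mainTheorem5 (n : ℕ) (S T : Finset (Fin n)) (hST : S.card = T.card) :
    ∃ Φ : ArcDiagram.partitionsST S T → ArcDiagram.partitionsST S T,
      (∀ P, ArcDiagram.phi P.1 = some (Φ P).1) ∧
      (∀ P, ArcDiagram.phiMatching (ArcDiagram.toMatching P.1) =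
        some (ArcDiagram.toMatching (Φ P).1)) ∧
      (∀ P, ArcDiagram.lefts (ArcDiagram.arcs (Φ P).1) = ArcDiagram.lefts (ArcDiagram.arcs P.1) ∧
        ArcDiagram.rights (ArcDiagram.arcs (Φ P).1) = ArcDiagram.rights (ArcDiagram.arcs P.1)) ∧
      Function.Bijective Φ := by
  have hmatch : ∀ P : ArcDiagram.partitionsST S T, ArcDiagram.IsMatching
      (ArcDiagram.rightVertices S) (ArcDiagram.leftVertices T) (ArcDiagram.toMatching P.1) := by
    rintro ⟨P, rfl, rfl⟩
    exact ArcDiagram.isMatching_toMatching P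
  choose M hphi hM using fun P => (hmatch P).exists_phiMatching
  refine ⟨fun P => ⟨ArcDiagram.ofMatching (M P), (hM P).ofMatching_mem_partitionsST⟩, fun P => ?_,
    fun P => ?_, fun P => ?_, Finite.injective_iff_bijective.1 fun P Q hPQ => ?_⟩
  · rw [ArcDiagram.phi, hphi P, Option.map_some]
  · rw [hphi P, (hM P).toMatching_ofMatching]
  · have h := (hM P).ofMatching_mem_partitionsST
    rw [ArcDiagram.lefts_arcs, ArcDiagram.lefts_arcs, ArcDiagram.rights_arcs,
      ArcDiagram.rights_arcs, h.1, h.2, P.2.1, P.2.2]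
    exact ⟨rfl, rfl⟩
  · have h := congrArg (fun R => ArcDiagram.toMatching R.1) hPQ
    simp only [(hM P).toMatching_ofMatching, (hM Q).toMatching_ofMatching] at h
    refine Subtype.ext (ArcDiagram.toMatching_injective ?_)
    exact (hmatch P).eq_of_phiMatching_eq (hmatch Q) (by rw [hphi P, hphi Q, h])
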